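/- Let $\|\cdot\|$ be the matrix 2-norm and, for a matrix with linearly independent columns, let $\kappa=\sigma_{\max}/\sigma_{\min}$ be its 2-norm condition number. Floating-point arithmetic with unit roundoff $\varepsilon>0$ follows the standard model: each $+,-,\times,/$ and square root returns the exact value times $1+\delta$ with $|\delta|\le\varepsilon$ (no overflow or underflow; negation is exact). A constant is a polynomial $c(m,ps)$ with nonnegative coefficients. Let $\mathcal X=[X_1\ \cdots\ X_p]\in\mathbb R^{m\times ps}$ have linearly independent columns, with $X_k\in\mathbb R^{m\times s}$, and let $\mathrm{IO}$ be an intraorthogonalization routine, a map $X\mapsto[\bar Q,\bar R]$ from $\mathbb R^{m\times s}$ to $\mathbb R^{m\times s}\times\mathbb R^{s\times s}$. The algorithm BCGS-PIPI+ computes $\mathcal Q=[Q_1\cdots Q_p]$ and a block upper triangular $\mathcal R=(R_{ij})$ as follows (write $\mathcal Q_k=[Q_1\cdots Q_k]$, $\mathcal R_k=\mathcal R_{1:k,1:k}$, $\mathcal X_k=[X_1\cdots X_k]$). Set $[Q_1,R_{11}]=\mathrm{IO}(X_1)$. For $k=2,\dots,p$ compute $$\begin{aligned} &\mathcal S_{1:k-1,k}=\mathcal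 Q_{k-1}^TX_k,\quad \Omega_k=X_k^TX_k,\quad S_{kk}=\mathrm{chol}(\Omega_k-\mathcal S_{1:k-1,k}^T\mathcal S_{1:k-1,k}),\quad V_k=X_k-\mathcal Q_{k-1}\mathcal S_{1:k-1,k},\quad U_k=V_kS_{kk}^{-1},\\ &\mathcal T_{1:k-1,k}=\mathcal Q_{k-1}^TU_k,\quad P_k=U_k^TU_k,\quad T_{kk}=\mathrm{chol}(P_k-\mathcal T_{1:k-1,k}^T\mathcal T_{1:k-1,k}),\quad W_k=U_k-\mathcal Q_{k-1}\mathcal T_{1:k-1,k},\quad Q_k=W_kT_{kk}^{-1},\\ &\mathcal R_{1:k-1,k}=\mathcal S_{1:k-1,k}+\mathcal T_{1:k-1,k}S_{kk},\quad R_{kk}=T_{kk}S_{kk}. \end{aligned}$$ Every line is executed in the same floating-point arithmetic: conventional matrix products, the entrywise Cholesky factorization with upper triangular factor $\mathrm{chol}(A)$, $\mathrm{chol}(A)^T\mathrm{chol}(A)=A$, and substitution for the multiplication by the inverse of a triangular matrix, all sums being evaluated in an arbitrary order. Computed quantities carry a bar. Claim. For all constants $c_1,c_2,c_3$ there are constants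 $c_0,c_4$ such that, for all $m,p,s$, all $\varepsilon>0$, every such arithmetic, and all $\mathcal X$ and $\mathrm{IO}$ as above, the following holds. Assume that $c_0(m,ps)\,\varepsilon\,\kappa^2(\mathcal X)\le\frac12$ and that for all $X\in\mathbb R^{m\times s}$ with linearly independent columns and $\kappa(X)\le\kappa(\mathcal X)$, the output $[\bar Q,\bar R]=\mathrm{IO}(X)$ satisfies $$\bar Q\bar R=X+\Delta D,\quad \|\Delta D\|\le c_1(m,ps)\,\varepsilon\,\|X\|,\qquad \|I-\bar Q^T\bar Q\|\le\frac{c_2(m,ps)\,\varepsilon}{1-c_3(m,ps)\,\varepsilon\,\kappa^2(X)}.$$ Then every floating-point execution of BCGS-PIPI+ on $\mathcal X$ is free of breakdown (all numbers whose square roots are taken in the Cholesky factorizations are positive), and for all $k\in\{1,\dots,p\}$ $$\bar{\mathcal Q}_k\bar{\mathcal R}_k=\mathcal X_k+\Delta\mathcal D_k,\qquad \|\Delta\mathcal D_k\|\le c_4(m,ps)\,\varepsilon\,\|\mathcal X_k\|.$$ -/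

import Mathlib

open scoped Matrix Matrix.Norms.L2Operator NNReal

namespace BlockGS

noncomputable section

/-! ## Floating-point arithmetic -/

/-- Floating-point arithmetic with unit roundoff `ε`, in the standard model: every operation returns
the exact result up to a relative error of at most `ε`. Negation is exact, so a subtraction is the
addition of a negated number. Nothing is assumed on a division by zero or on the square root of a
negative number, where an algorithm breaks down. -/
structure FlArith (ε : ℝ) where
  add : ℝ → ℝ → ℝ
  mul : ℝ → ℝ → ℝ
  div : ℝ → ℝ → ℝ
  sqrt : ℝ → ℝ
  add_spec : ∀ x y, ∃ δ : ℝ, |δ| ≤ ε ∧ add x y = (x + y) * (1 + δ)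
  mul_spec : ∀ x y, ∃ δ : ℝ, |δ| ≤ ε ∧ mul x y = (x * y) * (1 + δ)
  div_spec : ∀ x y, y ≠ 0 → ∃ δ : ℝ, |δ| ≤ ε ∧ div x y = (x / y) * (1 + δ)
  sqrt_spec : ∀ x, 0 ≤ x → ∃ δ : ℝ, |δ| ≤ ε ∧ sqrt x = Real.sqrt x * (1 + δ)

/-- `FlSum fl M z`: the number `z` is obtained by summing the members of the nonempty multiset `M`
in floating-point arithmetic, in some order and with some bracketing (each member is used exactly
once, so there are `card M - 1` floating-point additions). -/
inductive FlSum {ε : ℝ} (fl : FlArith ε) : Multiset ℝ → ℝ → Prop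
  | single (x : ℝ) : FlSum fl {x} x
  | neg {M : Multiset ℝ} {x : ℝ} : FlSum fl M x → FlSum fl (M.map fun t => -t) (-x)
  | add {M N : Multiset ℝ} {x y : ℝ} :
      FlSum fl M x → FlSum fl N y → FlSum fl (M + N) (fl.add x y)

/-- `C` is the computed product `A B`. -/
def FlMul {ε : ℝ} (fl : FlArith ε) {ι κ ν : Type*} [Fintype κ]
    (A : Matrix ι κ ℝ) (B : Matrix κ ν ℝ) (C : Matrix ι ν ℝ) : Prop :=
  ∀ i j, FlSum fl (Finset.univ.val.map fun l : κ => fl.mul (A i l) (B l j)) (C i j)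

/-- `D` is the computed value of `C + A B`. -/
def FlAddMul {ε : ℝ} (fl : FlArith ε) {ι κ ν : Type*} [Fintype κ]
    (C : Matrix ι ν ℝ) (A : Matrix ι κ ℝ) (B : Matrix κ ν ℝ) (D : Matrix ι ν ℝ) : Prop :=
  ∀ i j, FlSum fl (C i j ::ₘ Finset.univ.val.map fun l : κ => fl.mul (A i l) (B l j)) (D i j)

/-- `D` is the computed value of `C - A B`. -/
def FlSubMul {ε : ℝ} (fl : FlArith ε) {ι κ ν : Type*} [Fintype κ]
    (C : Matrix ι ν ℝ) (A : Matrix ι κ ℝ) (B : Matrix κ ν ℝ) (D : Matrix ι ν ℝ) : Prop :=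
  ∀ i j, FlSum fl (C i j ::ₘ Finset.univ.val.map fun l : κ => -fl.mul (A i l) (B l j)) (D i j)

/-- `L` is the upper triangular Cholesky factor `chol A` (so that `Lᵀ L ≈ A`) computed in
floating-point arithmetic from the upper triangle of `A`, and `d j` is the computed number whose
square root is taken for the `j`-th diagonal entry. The factorization breaks down if some `d j` is
not positive. -/
structure FlChol {ε : ℝ} (fl : FlArith ε) {s : ℕ} (A L : Matrix (Fin s) (Fin s) ℝ)
    (d : Fin s → ℝ) : Prop where
  lower : ∀ i j, j < i → L i j = 0
  pivot : ∀ j, FlSum fl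
    (A j j ::ₘ (Finset.Iio j).val.map fun l => -fl.mul (L l j) (L l j)) (d j)
  diag : ∀ j, L j j = fl.sqrt (d j)
  upper : ∀ i j, i < j → ∃ z, FlSum fl
    (A i j ::ₘ (Finset.Iio i).val.map fun l => -fl.mul (L l i) (L l j)) z ∧
      L i j = fl.div z (L i i)

/-- `Z` is the solution of `Z L = V`, with `L` upper triangular, computed by substitution in
floating-point arithmetic. -/
def FlTriSolve {ε : ℝ} (fl : FlArith ε) {m s : ℕ} (V : Matrix (Fin m) (Fin s) ℝ)
    (L : Matrix (Fin s) (Fin s) ℝ) (Z : Matrix (Fin m) (Fin s) ℝ) : Prop :=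
  ∀ i j, ∃ z, FlSum fl
    (V i j ::ₘ (Finset.Iio j).val.map fun l => -fl.mul (Z i l) (L l j)) z ∧
      Z i j = fl.div z (L j j)

/-! ## Block matrices -/

/-- Column indices of the first `k - 1` blocks, those strictly before block `k`. -/
abbrev Before {p : ℕ} (s : ℕ) (k : Fin p) : Type := {j : Fin p // j < k} × Fin s

/-- Column indices of the first `k` blocks, block `k` included. -/
abbrev UpTo {p : ℕ} (s : ℕ) (k : Fin p) : Type := {j : Fin p // j ≤ k} × Fin s

variable {m p s : ℕ}

/-- The `k`-th block column (an `m × s` block vector). -/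
def blockCol (A : Matrix (Fin m) (Fin p × Fin s) ℝ) (k : Fin p) : Matrix (Fin m) (Fin s) ℝ :=
  A.submatrix id fun b => (k, b)

/-- The concatenation of the block columns strictly before `k`. -/
def colsBefore (A : Matrix (Fin m) (Fin p × Fin s) ℝ) (k : Fin p) :
    Matrix (Fin m) (Before s k) ℝ :=
  A.submatrix id fun j => (j.1.1, j.2)

/-- The concatenation of the block columns up to and including `k`. -/
def colsUpTo (A : Matrix (Fin m) (Fin p × Fin s) ℝ) (k : Fin p) :
    Matrix (Fin m) (UpTo s k) ℝ :=
  A.submatrix id fun j => (j.1.1, j.2)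

/-- The leading principal block submatrix `R_{1:k,1:k}`. -/
def leading (R : Matrix (Fin p × Fin s) (Fin p × Fin s) ℝ) (k : Fin p) :
    Matrix (UpTo s k) (UpTo s k) ℝ :=
  R.submatrix (fun i => (i.1.1, i.2)) fun j => (j.1.1, j.2)

/-- The part `R_{1:k-1,k}` of the `k`-th block column above the diagonal block. -/
def aboveDiag (R : Matrix (Fin p × Fin s) (Fin p × Fin s) ℝ) (k : Fin p) :
    Matrix (Before s k) (Fin s) ℝ :=
  R.submatrix (fun i => (i.1.1, i.2)) fun b => (k, b)

/-- The `s × s` block `R_{ij}`. -/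
def block (R : Matrix (Fin p × Fin s) (Fin p × Fin s) ℝ) (i j : Fin p) :
    Matrix (Fin s) (Fin s) ℝ :=
  R.submatrix (fun a => (i, a)) fun b => (j, b)

/-- The 2-norm condition number of a real matrix with at least as many rows as columns: the ratio of
the largest to the smallest singular value. It is meaningful for linearly independent columns. -/
def cond {ι ν : Type*} [Fintype ι] [Fintype ν] [DecidableEq ν]
    (A : Matrix ι ν ℝ) : ℝ :=
  (Matrix.toEuclideanLin A).singularValues 0 /
    (Matrix.toEuclideanLin A).singularValues (Fintype.card ν - 1)

/-! ## The algorithm in floating-point arithmetic -/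

/-- One computed BCGS-PIP step for the block vector `Y` against the basis `Qprev`:
`[coef; gram] = [Qprev, Y]ᵀ Y`, `schur = gram - coefᵀ coef`, `fac = chol schur`,
`proj = Y - Qprev coef`, `out = proj fac⁻¹`. -/
structure PIPStep {ε : ℝ} (fl : FlArith ε) {κ : Type} [Fintype κ]
    (Qprev : Matrix (Fin m) κ ℝ) (Y : Matrix (Fin m) (Fin s) ℝ) where
  coef : Matrix κ (Fin s) ℝ
  gram : Matrix (Fin s) (Fin s) ℝ
  schur : Matrix (Fin s) (Fin s) ℝ
  fac : Matrix (Fin s) (Fin s) ℝ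
  pivot : Fin s → ℝ
  proj : Matrix (Fin m) (Fin s) ℝ
  out : Matrix (Fin m) (Fin s) ℝ
  coef_spec : FlMul fl Qprevᵀ Y coef
  gram_spec : FlMul fl Yᵀ Y gram
  schur_spec : FlSubMul fl gram coefᵀ coef schur
  fac_spec : FlChol fl schur fac pivot
  proj_spec : FlSubMul fl Y Qprev coef proj
  out_spec : FlTriSolve fl proj fac out

/-- The step does not break down: every number whose square root is taken is positive. -/
def PIPStep.Succeeds {ε : ℝ} {fl : FlArith ε} {κ : Type} [Fintype κ]
    {Qprev : Matrix (Fin m) κ ℝ} {Y : Matrix (Fin m) (Fin s) ℝ} (st : PIPStep fl Qprev Y) : Prop :=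
  ∀ j, 0 < st.pivot j

/-- A run in floating-point arithmetic of BCGS-PIPI+ on `X`, whose first block is orthogonalized by
the routine `intra`. For every later block `k`, `first` yields `S_{1:k-1,k}`, `S_kk`, `U_k` (as `coef`,
`fac`, `out`), and `second` yields `T_{1:k-1,k}`, `T_kk`, `Q_k`. -/
structure PIPIPlusRun {ε : ℝ} (fl : FlArith ε)
    (intra : Matrix (Fin m) (Fin s) ℝ → Matrix (Fin m) (Fin s) ℝ × Matrix (Fin s) (Fin s) ℝ)
    (X : Matrix (Fin m) (Fin p × Fin s) ℝ) where
  Q : Matrix (Fin m) (Fin p × Fin s) ℝ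
  R : Matrix (Fin p × Fin s) (Fin p × Fin s) ℝ
  R_lower : ∀ i j, j < i → block R i j = 0
  init : ∀ k : Fin p, (k : ℕ) = 0 → (blockCol Q k, block R k k) = intra (blockCol X k)
  first : ∀ k : Fin p, 0 < (k : ℕ) → PIPStep fl (colsBefore Q k) (blockCol X k)
  second : ∀ (k : Fin p) (hk : 0 < (k : ℕ)), PIPStep fl (colsBefore Q k) (first k hk).out
  Q_spec : ∀ (k : Fin p) (hk : 0 < (k : ℕ)), blockCol Q k = (second k hk).out
  R_above : ∀ (k : Fin p) (hk : 0 < (k : ℕ)),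
    FlAddMul fl (first k hk).coef (second k hk).coef (first k hk).fac (aboveDiag R k)
  R_diag : ∀ (k : Fin p) (hk : 0 < (k : ℕ)),
    FlMul fl (second k hk).fac (first k hk).fac (block R k k)

/-- The value at `(m, n)` of a polynomial with nonnegative coefficients in two dimensional
constants. -/
def dimConst (c : MvPolynomial (Fin 2) ℝ≥0) (m n : ℕ) : ℝ :=
  ((MvPolynomial.eval ![(m : ℝ≥0), (n : ℝ≥0)] c : ℝ≥0) : ℝ)

end

end BlockGS

set_option linter.unusedSectionVars false

/-! The proof is an induction over the blocks with two invariants: the loss of orthogonality of the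
computed basis is O(ε), free of the condition number, and the residual is O(ε) relative to `X`.

Let α be the norm of the block `X_k` and σ half the smallest singular value of `X`. A small residual
makes the range of the previous basis that of a slightly perturbed `X_{<k}`, so `X_k` stays at
distance at least σ from it (`separation`). Up to the loss of orthogonality, the Schur complement is
the Gram matrix of the projected block, so its eigenvalues are at least about σ², whereas rounding
perturbs it by O(εα²). As εκ² is small, Cholesky cannot break down (`FlChol.pivot_pos`), and its
factor matches the projected block so well that the quotient `U` has norm at most 2 whatever κ is
(`StepHyp.norm_out`). Its defects, O(εκ) against the basis and O(εκ²) within the block, are below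
fixed fractions. The second step thus receives a block of norm at most 2 at distance at least 1/2
from the basis, and its own loss of orthogonality is O(ε) (`DoubleHyp.cross_le`,
`DoubleHyp.one_sub_gram_le`).

Residuals never meet κ: they arise by multiplying back by bounded computed factors, not by inverses
(`DoubleHyp.residual_le`).

The constants stay polynomial because old losses are not amplified. In the second step the old loss
`K * ζ` is multiplied by the cross term left by the first, and the product is at most `ζ`
(`DoubleHyp.cross_bound`). Each block therefore adds a fixed multiple of `ζ`, so `K` grows linearly
in `p`. Here `h` measures the error of one matrix operation, and `ζ` has one more factor of the
dimension for Cholesky. -/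

namespace BlockGS

/-! ### Euclidean and operator norms, and their relation to entries. -/

section Norms

variable {ι κ ν : Type*} [Fintype ι] [Fintype κ] [Fintype ν]

/-- The Euclidean norm of a real vector. -/
noncomputable def vnorm (v : ι → ℝ) : ℝ := ‖WithLp.toLp 2 v‖

lemma vnorm_nonneg (v : ι → ℝ) : 0 ≤ vnorm v := norm_nonneg _

lemma vnorm_sq (v : ι → ℝ) : vnorm v ^ 2 = v ⬝ᵥ v := by
  rw [vnorm, EuclideanSpace.norm_sq_eq]
  simp [dotProduct, sq]

lemma vnorm_sq_eq_sum (v : ι → ℝ) : vnorm v ^ 2 = ∑ i, v i ^ 2 := by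
  rw [vnorm_sq]
  simp [dotProduct, sq]

lemma vnorm_add_le (u v : ι → ℝ) : vnorm (u + v) ≤ vnorm u + vnorm v :=
  norm_add_le (WithLp.toLp 2 u) (WithLp.toLp 2 v)

lemma vnorm_sub_le (u v : ι → ℝ) : vnorm u - vnorm v ≤ vnorm (u + v) := by
  have := norm_sub_le (WithLp.toLp 2 (u + v)) (WithLp.toLp 2 v)
  have h : WithLp.toLp 2 (u + v) - WithLp.toLp 2 v = WithLp.toLp 2 u := by
    ext i; simp
  rw [h] at this
  unfold vnorm
  linarith

lemma vnorm_zero : vnorm (0 : ι → ℝ) = 0 := by simp [vnorm]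

lemma vnorm_eq_zero {v : ι → ℝ} : vnorm v = 0 ↔ v = 0 := by
  rw [vnorm, norm_eq_zero]
  exact WithLp.toLp_eq_zero 2

lemma abs_dotProduct_le (u v : ι → ℝ) : |u ⬝ᵥ v| ≤ vnorm u * vnorm v := by
  have h := abs_real_inner_le_norm (WithLp.toLp 2 v) (WithLp.toLp 2 u)
  rw [EuclideanSpace.inner_eq_star_dotProduct] at h
  simpa [vnorm, mul_comm] using h

variable [DecidableEq κ] [DecidableEq ι] [DecidableEq ν]

lemma vnorm_mulVec_le (A : Matrix ι κ ℝ) (v : κ → ℝ) : vnorm (A *ᵥ v) ≤ ‖A‖ * vnorm v :=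
  Matrix.l2_opNorm_mulVec A (WithLp.toLp 2 v)

lemma norm_le_of_vnorm (A : Matrix ι κ ℝ) {c : ℝ} (hc : 0 ≤ c)
    (h : ∀ v, vnorm (A *ᵥ v) ≤ c * vnorm v) : ‖A‖ ≤ c := by
  rw [Matrix.l2_opNorm_def]
  refine ContinuousLinearMap.opNorm_le_bound _ hc fun x => ?_
  exact h x.ofLp

lemma vnorm_single (i : ι) : vnorm (Pi.single i (1 : ℝ)) = 1 := by
  simp [vnorm]

lemma norm_le_of_bilin (A : Matrix ι κ ℝ) {c : ℝ} (hc : 0 ≤ c)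
    (h : ∀ u v, |u ⬝ᵥ A *ᵥ v| ≤ c * (vnorm u * vnorm v)) : ‖A‖ ≤ c := by
  refine norm_le_of_vnorm A hc fun v => ?_
  have h1 := h (A *ᵥ v) v
  rw [← vnorm_sq, abs_of_nonneg (sq_nonneg _)] at h1
  rcases (vnorm_nonneg (A *ᵥ v)).eq_or_lt with h0 | h0
  · rw [← h0]; exact mul_nonneg hc (vnorm_nonneg v)
  · nlinarith

lemma norm_transpose_eq (A : Matrix ι κ ℝ) : ‖Aᵀ‖ = ‖A‖ := by
  rw [← Matrix.conjTranspose_eq_transpose_of_trivial, Matrix.l2_opNorm_conjTranspose]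

lemma norm_transpose_mul_self (A : Matrix ι κ ℝ) : ‖Aᵀ * A‖ = ‖A‖ ^ 2 := by
  rw [← Matrix.conjTranspose_eq_transpose_of_trivial, Matrix.l2_opNorm_conjTranspose_mul_self, sq]

lemma norm_mul_le_of_le {A : Matrix ι κ ℝ} {B : Matrix κ ν ℝ} {a b : ℝ}
    (hA : ‖A‖ ≤ a) (hB : ‖B‖ ≤ b) : ‖A * B‖ ≤ a * b :=
  (Matrix.l2_opNorm_mul A B).trans
    (mul_le_mul hA hB (norm_nonneg _) ((norm_nonneg _).trans hA))

lemma norm_transpose_le {A : Matrix ι κ ℝ} {a : ℝ} (hA : ‖A‖ ≤ a) : ‖Aᵀ‖ ≤ a :=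
  (norm_transpose_eq A).trans_le hA

lemma norm_one_le : ‖(1 : Matrix κ κ ℝ)‖ ≤ 1 :=
  norm_le_of_vnorm _ zero_le_one fun v => by simp

lemma row_sum_sq_le (A : Matrix ι κ ℝ) (i : ι) : ∑ l, A i l ^ 2 ≤ ‖A‖ ^ 2 := by
  have h := vnorm_mulVec_le Aᵀ (Pi.single i 1)
  rw [norm_transpose_eq, vnorm_single, mul_one, Matrix.mulVec_single_one] at h
  have h2 := pow_le_pow_left₀ (vnorm_nonneg _) h 2
  rw [vnorm_sq_eq_sum] at h2
  simpa using h2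

lemma col_sum_sq_le (A : Matrix ι κ ℝ) (j : κ) : ∑ l, A l j ^ 2 ≤ ‖A‖ ^ 2 := by
  simpa [norm_transpose_eq] using row_sum_sq_le Aᵀ j

lemma abs_entry_le (A : Matrix ι κ ℝ) (i : ι) (j : κ) : |A i j| ≤ ‖A‖ := by
  refine abs_le_of_sq_le_sq ?_ (norm_nonneg _)
  refine le_trans ?_ (row_sum_sq_le A i)
  exact Finset.single_le_sum (f := fun l => A i l ^ 2) (fun l _ => sq_nonneg _) (Finset.mem_univ j)

lemma sum_abs_mul_le {τ : Type*} (t : Finset τ) (f g : τ → ℝ) {a b : ℝ} (ha : 0 ≤ a) (hb : 0 ≤ b)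
    (hf : ∑ l ∈ t, f l ^ 2 ≤ a ^ 2) (hg : ∑ l ∈ t, g l ^ 2 ≤ b ^ 2) :
    ∑ l ∈ t, |f l * g l| ≤ a * b := by
  have h := Finset.sum_mul_sq_le_sq_mul_sq t (fun l => |f l|) (fun l => |g l|)
  simp only [sq_abs, ← abs_mul] at h
  refine le_of_sq_le_sq ?_ (mul_nonneg ha hb)
  calc _ ≤ _ := h
    _ ≤ a ^ 2 * b ^ 2 := by
      exact mul_le_mul hf hg (Finset.sum_nonneg fun _ _ => sq_nonneg _) (sq_nonneg _)
    _ = _ := by ring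

lemma sum_abs_entries_le (A : Matrix ι κ ℝ) (B : Matrix κ ν ℝ) (t : Finset κ) (i : ι) (j : ν) :
    ∑ l ∈ t, |A i l * B l j| ≤ ‖A‖ * ‖B‖ :=
  sum_abs_mul_le t _ _ (norm_nonneg _) (norm_nonneg _)
    ((Finset.sum_le_univ_sum_of_nonneg fun _ => sq_nonneg _).trans (row_sum_sq_le A i))
    ((Finset.sum_le_univ_sum_of_nonneg fun _ => sq_nonneg _).trans (col_sum_sq_le B j))

lemma sum_abs_le_vnorm (v : ι → ℝ) {N : ℕ} (hN : Fintype.card ι ≤ N) :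
    (∑ i, |v i|) ^ 2 ≤ N * vnorm v ^ 2 := by
  have h := sq_sum_le_card_mul_sum_sq (s := (Finset.univ : Finset ι)) (f := fun i => |v i|)
  simp only [sq_abs] at h
  rw [vnorm_sq_eq_sum]
  refine h.trans ?_
  refine mul_le_mul_of_nonneg_right ?_ (Finset.sum_nonneg fun _ _ => sq_nonneg _)
  exact_mod_cast hN

/-- Cauchy–Schwarz on both index sets. Rounding errors are bounded entrywise, and this is where they
acquire a factor of the dimension. -/
lemma norm_le_of_entry_le (A : Matrix ι κ ℝ) {N : ℕ} (hι : Fintype.card ι ≤ N)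
    (hκ : Fintype.card κ ≤ N) {e : ℝ} (he : 0 ≤ e) (h : ∀ i j, |A i j| ≤ e) : ‖A‖ ≤ N * e := by
  refine norm_le_of_bilin A (by positivity) fun u v => ?_
  have h1 : |u ⬝ᵥ A *ᵥ v| ≤ e * ((∑ i, |u i|) * ∑ j, |v j|) := by
    rw [Finset.sum_mul_sum, Finset.mul_sum]
    refine (Finset.abs_sum_le_sum_abs _ _).trans (Finset.sum_le_sum fun i _ => ?_)
    rw [abs_mul, Finset.mul_sum]
    refine (mul_le_mul_of_nonneg_left (Finset.abs_sum_le_sum_abs _ _) (abs_nonneg _)).trans ?_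
    rw [Finset.mul_sum]
    refine Finset.sum_le_sum fun j _ => ?_
    rw [abs_mul]
    have := mul_le_mul_of_nonneg_right (h i j) (mul_nonneg (abs_nonneg (u i)) (abs_nonneg (v j)))
    linarith
  have h2 : (∑ i, |u i|) * ∑ j, |v j| ≤ N * (vnorm u * vnorm v) := by
    refine le_of_sq_le_sq ?_
      (mul_nonneg (Nat.cast_nonneg _) (mul_nonneg (vnorm_nonneg _) (vnorm_nonneg _)))
    have := mul_le_mul (sum_abs_le_vnorm u hι) (sum_abs_le_vnorm v hκ) (sq_nonneg _)
      (by positivity)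
    nlinarith
  nlinarith

lemma exists_inverse_of_lower_bound (A : Matrix κ κ ℝ) {a : ℝ} (ha : 0 < a)
    (h : ∀ v, a * vnorm v ≤ vnorm (A *ᵥ v)) :
    ∃ B : Matrix κ κ ℝ, A * B = 1 ∧ B * A = 1 ∧ ‖B‖ ≤ 1 / a := by
  have hinj : Function.Injective A.mulVec := by
    intro u v huv
    have h1 := h (u - v)
    have h2 : A *ᵥ (u - v) = 0 := by
      rw [Matrix.mulVec_sub, sub_eq_zero]; exact huv
    rw [h2, vnorm_zero] at h1
    have h3 : vnorm (u - v) = 0 := le_antisymm (by nlinarith) (vnorm_nonneg _)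
    exact sub_eq_zero.1 (vnorm_eq_zero.1 h3)
  have hu : IsUnit A := Matrix.mulVec_injective_iff_isUnit.1 hinj
  have hd : IsUnit A.det := (Matrix.isUnit_iff_isUnit_det A).1 hu
  refine ⟨A⁻¹, Matrix.mul_nonsing_inv A hd, Matrix.nonsing_inv_mul A hd, ?_⟩
  refine norm_le_of_vnorm _ (by positivity) fun v => ?_
  have h1 := h (A⁻¹ *ᵥ v)
  rw [Matrix.mulVec_mulVec, Matrix.mul_nonsing_inv A hd, Matrix.one_mulVec] at h1
  rw [div_mul_eq_mul_div, one_mul, le_div_iff₀ ha]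
  linarith

end Norms

/-! ### Extreme singular values and the condition number. -/

section Cond

open Module

/-- Expansion in an eigenbasis of `T* T`. The variational bounds by the largest and the smallest
singular value are read off from it. -/
lemma norm_sq_eq_sum_singularValues {E F : Type*} [NormedAddCommGroup E] [InnerProductSpace ℝ E]
    [FiniteDimensional ℝ E] [NormedAddCommGroup F] [InnerProductSpace ℝ F] [FiniteDimensional ℝ F]
    (T : E →ₗ[ℝ] F) {n : ℕ} (hn : finrank ℝ E = n) (v : E) :
    ‖T v‖ ^ 2 = ∑ i : Fin n, T.singularValues i ^ 2 *
      ((T.isSymmetric_adjoint_comp_self.eigenvectorBasis hn).repr v i) ^ 2 := by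
  set b := T.isSymmetric_adjoint_comp_self.eigenvectorBasis hn
  have h1 : ‖T v‖ ^ 2 = inner ℝ ((LinearMap.adjoint T ∘ₗ T) v) v := by
    rw [LinearMap.comp_apply, LinearMap.adjoint_inner_left, real_inner_self_eq_norm_sq]
  rw [h1, ← b.repr.inner_map_map, EuclideanSpace.inner_eq_star_dotProduct]
  simp only [dotProduct]
  refine Finset.sum_congr rfl fun i _ => ?_
  have h2 := T.isSymmetric_adjoint_comp_self.eigenvectorBasis_apply_self_apply hn v i
  rw [T.sq_singularValues_fin hn]
  simp only [Pi.star_apply, star_trivial]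
  erw [h2]
  simp only [RCLike.ofReal_real_eq_id, id_eq]
  ring

variable {ι ν : Type*} [Fintype ι] [Fintype ν] [DecidableEq ι] [DecidableEq ν]

/-- The smallest singular value of a matrix with `card ν` columns. -/
noncomputable def sigmaMin (A : Matrix ι ν ℝ) : ℝ :=
  (Matrix.toEuclideanLin A).singularValues (Fintype.card ν - 1)


lemma vnorm_mulVec_sq (A : Matrix ι ν ℝ) (v : ν → ℝ) :
    vnorm (A *ᵥ v) ^ 2 = ∑ i : Fin (Fintype.card ν),
      (Matrix.toEuclideanLin A).singularValues i ^ 2 *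
      (((Matrix.toEuclideanLin A).isSymmetric_adjoint_comp_self.eigenvectorBasis
        finrank_euclideanSpace).repr (WithLp.toLp 2 v) i) ^ 2 :=
  norm_sq_eq_sum_singularValues (Matrix.toEuclideanLin A) finrank_euclideanSpace (WithLp.toLp 2 v)

lemma vnorm_sq_repr {n : ℕ} (b : OrthonormalBasis (Fin n) ℝ (EuclideanSpace ℝ ν)) (v : ν → ℝ) :
    vnorm v ^ 2 = ∑ i, (b.repr (WithLp.toLp 2 v) i) ^ 2 := by
  rw [vnorm, ← b.repr.norm_map, EuclideanSpace.norm_sq_eq]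
  simp

lemma norm_le_singularValues_zero (A : Matrix ι ν ℝ) :
    ‖A‖ ≤ (Matrix.toEuclideanLin A).singularValues 0 := by
  refine norm_le_of_vnorm _ (LinearMap.singularValues_nonneg _ _) fun v => ?_
  refine le_of_sq_le_sq ?_ (mul_nonneg (LinearMap.singularValues_nonneg _ _) (vnorm_nonneg v))
  rw [mul_pow, vnorm_mulVec_sq, vnorm_sq_repr
    ((Matrix.toEuclideanLin A).isSymmetric_adjoint_comp_self.eigenvectorBasis
        finrank_euclideanSpace), Finset.mul_sum]
  refine Finset.sum_le_sum fun i _ => mul_le_mul_of_nonneg_right ?_ (sq_nonneg _)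
  exact pow_le_pow_left₀ (LinearMap.singularValues_nonneg _ _)
    (LinearMap.singularValues_antitone _ (Nat.zero_le _)) 2

lemma sigmaMin_nonneg (A : Matrix ι ν ℝ) : 0 ≤ sigmaMin A := LinearMap.singularValues_nonneg _ _

lemma sigmaMin_mul_vnorm_le (A : Matrix ι ν ℝ) (v : ν → ℝ) :
    sigmaMin A * vnorm v ≤ vnorm (A *ᵥ v) := by
  refine le_of_sq_le_sq ?_ (vnorm_nonneg _)
  rw [mul_pow, vnorm_mulVec_sq, vnorm_sq_repr
    ((Matrix.toEuclideanLin A).isSymmetric_adjoint_comp_self.eigenvectorBasis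
        finrank_euclideanSpace), Finset.mul_sum]
  refine Finset.sum_le_sum fun i _ => mul_le_mul_of_nonneg_right ?_ (sq_nonneg _)
  exact pow_le_pow_left₀ (LinearMap.singularValues_nonneg _ _)
    (LinearMap.singularValues_antitone _ (by omega)) 2

lemma exists_vnorm_mulVec_eq_singularValue (A : Matrix ι ν ℝ) {k : ℕ} (hk : k < Fintype.card ν) :
    ∃ v : ν → ℝ, vnorm v = 1 ∧ vnorm (A *ᵥ v) = (Matrix.toEuclideanLin A).singularValues k := by
  set b := (Matrix.toEuclideanLin A).isSymmetric_adjoint_comp_self.eigenvectorBasis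
        (finrank_euclideanSpace (ι := ν)) with hb
  refine ⟨(b ⟨k, hk⟩).ofLp, b.orthonormal.1 _, ?_⟩
  refine (pow_left_inj₀ (vnorm_nonneg _) (LinearMap.singularValues_nonneg _ _) two_ne_zero).1 ?_
  rw [vnorm_mulVec_sq, ← hb, Finset.sum_eq_single ⟨k, hk⟩]
  · simp
  · intro i _ hi
    simp [hi]
  · simp

lemma singularValues_zero_le_norm (A : Matrix ι ν ℝ) [Nonempty ν] :
    (Matrix.toEuclideanLin A).singularValues 0 ≤ ‖A‖ := by
  obtain ⟨v, hv, h⟩ := exists_vnorm_mulVec_eq_singularValue A Fintype.card_pos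
  have := vnorm_mulVec_le A v
  rwa [h, hv, mul_one] at this

lemma le_sigmaMin [Nonempty ν] (A : Matrix ι ν ℝ) {c : ℝ}
    (h : ∀ v, c * vnorm v ≤ vnorm (A *ᵥ v)) : c ≤ sigmaMin A := by
  obtain ⟨v, hv, h1⟩ := exists_vnorm_mulVec_eq_singularValue A
    (Nat.sub_lt (Fintype.card_pos (α := ν)) one_pos)
  have := h v
  rwa [h1, hv, mul_one] at this

lemma sigmaMin_pos [Nonempty ν] (A : Matrix ι ν ℝ) (h : LinearIndependent ℝ A.col) :
    0 < sigmaMin A := by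
  obtain ⟨v, hv, h1⟩ := exists_vnorm_mulVec_eq_singularValue A
    (Nat.sub_lt (Fintype.card_pos (α := ν)) one_pos)
  refine (sigmaMin_nonneg A).lt_of_ne fun h0 => ?_
  rw [← sigmaMin, ← h0, vnorm_eq_zero] at h1
  have h2 : v = 0 := Matrix.mulVec_injective_iff.2 h (by rw [h1, Matrix.mulVec_zero])
  rw [h2, vnorm_zero] at hv
  exact zero_ne_one hv

lemma cond_eq [Nonempty ν] (A : Matrix ι ν ℝ) : cond A = ‖A‖ / sigmaMin A := by
  rw [cond, le_antisymm (singularValues_zero_le_norm A) (norm_le_singularValues_zero A)]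
  rfl

end Cond
-- Rounding errors of sums, products and substitution.
section Rounding

variable {ε : ℝ} {fl : FlArith ε}

/-- An addition costs one factor `1 + ε`. Both summed parts are nonempty, so the exponent of either
part grows by at least one, which pays for it; this is why the cardinality is part of the induction.
-/
lemma FlSum.card_pos_and_error (hε : 0 ≤ ε) {M : Multiset ℝ} {z : ℝ} (h : FlSum fl M z) :
    1 ≤ M.card ∧ |z - M.sum| ≤ ((1 + ε) ^ M.card - 1) * (M.map fun t => |t|).sum := by
  induction h with
  | single x => simpa using mul_nonneg hε (abs_nonneg x)
  | @neg M x _ ih =>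
    refine ⟨by simpa using ih.1, ?_⟩
    have h1 : -x - (M.map fun t => -t).sum = -(x - M.sum) := by
      rw [Multiset.sum_map_neg]; simp; ring
    rw [h1, abs_neg]
    simpa using ih.2
  | @add M N x y _ _ ihM ihN =>
    obtain ⟨hM, hx⟩ := ihM
    obtain ⟨hN, hy⟩ := ihN
    refine ⟨by rw [Multiset.card_add]; omega, ?_⟩
    obtain ⟨δ, hδ, he⟩ := fl.add_spec x y
    rw [he, Multiset.card_add, Multiset.sum_add, Multiset.map_add, Multiset.sum_add]
    have hxM : |M.sum| ≤ (M.map fun t => |t|).sum := Multiset.abs_sum_le_sum_abs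
    have hyN : |N.sum| ≤ (N.map fun t => |t|).sum := Multiset.abs_sum_le_sum_abs
    have hq1 : (1 + ε) ^ M.card * (1 + ε) ≤ (1 + ε) ^ (M.card + N.card) := by
      rw [← pow_succ]; exact pow_le_pow_right₀ (by linarith) (by omega)
    have hq2 : (1 + ε) ^ N.card * (1 + ε) ≤ (1 + ε) ^ (M.card + N.card) := by
      rw [← pow_succ]; exact pow_le_pow_right₀ (by linarith) (by omega)
    set A := (M.map fun t => |t|).sum
    set B := (N.map fun t => |t|).sum
    set a := (1 + ε) ^ M.card
    set b := (1 + ε) ^ N.card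
    set q := (1 + ε) ^ (M.card + N.card)
    have hA : 0 ≤ A := (abs_nonneg _).trans hxM
    have hB : 0 ≤ B := (abs_nonneg _).trans hyN
    have hx2 : |x| ≤ a * A := by
      have := abs_add_le (x - M.sum) M.sum
      rw [sub_add_cancel] at this
      linarith
    have hy2 : |y| ≤ b * B := by
      have := abs_add_le (y - N.sum) N.sum
      rw [sub_add_cancel] at this
      linarith
    have h1 : (x + y) * (1 + δ) - (M.sum + N.sum)
        = (x - M.sum) + (y - N.sum) + δ * x + δ * y := by ring
    rw [h1]
    have h2 : |δ * x| ≤ ε * (a * A) := by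
      rw [abs_mul]; exact mul_le_mul hδ hx2 (abs_nonneg _) hε
    have h3 : |δ * y| ≤ ε * (b * B) := by
      rw [abs_mul]; exact mul_le_mul hδ hy2 (abs_nonneg _) hε
    have h4 := abs_add_le ((x - M.sum) + (y - N.sum) + δ * x) (δ * y)
    have h5 := abs_add_le ((x - M.sum) + (y - N.sum)) (δ * x)
    have h6 := abs_add_le (x - M.sum) (y - N.sum)
    have h7 := mul_le_mul_of_nonneg_right hq1 hA
    have h8 := mul_le_mul_of_nonneg_right hq2 hB
    nlinarith

/-- The members of `C` enter exactly, while `f` is a rounded version of `h`. One further power of `1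
+ ε` absorbs the rounding of the products. -/
lemma FlSum.error_of_terms (hε : 0 ≤ ε) {τ : Type*} (t : Finset τ) (C : Multiset ℝ) {f h : τ → ℝ}
    (hf : ∀ l, |f l - h l| ≤ ε * |h l|) {z : ℝ} (hz : FlSum fl (C + t.val.map f) z) :
    |z - (C.sum + ∑ l ∈ t, h l)| ≤
      ((1 + ε) ^ (C.card + t.card + 1) - 1) * ((C.map fun x => |x|).sum + ∑ l ∈ t, |h l|) := by
  have h1 := (hz.card_pos_and_error hε).2
  rw [Multiset.card_add, Multiset.card_map, Multiset.sum_add, Multiset.map_add, Multiset.sum_add,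
    Multiset.map_map] at h1
  change |z - (C.sum + ∑ l ∈ t, f l)| ≤ ((1 + ε) ^ (C.card + t.card) - 1) *
    ((C.map fun x => |x|).sum + ∑ l ∈ t, |f l|) at h1
  have hC : 0 ≤ (C.map fun x => |x|).sum :=
    (abs_nonneg C.sum).trans Multiset.abs_sum_le_sum_abs
  have hq : 1 ≤ (1 + ε) ^ (C.card + t.card) := one_le_pow₀ (by linarith)
  rw [pow_succ]
  set q := (1 + ε) ^ (C.card + t.card)
  set c := (C.map fun x => |x|).sum
  have h2 : ∑ l ∈ t, |f l| ≤ (1 + ε) * ∑ l ∈ t, |h l| := by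
    rw [Finset.mul_sum]
    refine Finset.sum_le_sum fun l _ => ?_
    have := abs_add_le (f l - h l) (h l)
    rw [sub_add_cancel] at this
    linarith [hf l]
  have h3 : |∑ l ∈ t, f l - ∑ l ∈ t, h l| ≤ ε * ∑ l ∈ t, |h l| := by
    rw [← Finset.sum_sub_distrib, Finset.mul_sum]
    exact (Finset.abs_sum_le_sum_abs _ _).trans (Finset.sum_le_sum fun l _ => hf l)
  have h4 := abs_add_le (z - (C.sum + ∑ l ∈ t, f l)) (∑ l ∈ t, f l - ∑ l ∈ t, h l)
  have h5 : z - (C.sum + ∑ l ∈ t, f l) + (∑ l ∈ t, f l - ∑ l ∈ t, h l)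
      = z - (C.sum + ∑ l ∈ t, h l) := by ring
  rw [h5] at h4
  have h6 : 0 ≤ ∑ l ∈ t, |h l| := Finset.sum_nonneg fun _ _ => abs_nonneg _
  have h7 := mul_le_mul_of_nonneg_left h2 (sub_nonneg.2 hq)
  have h8 : 0 ≤ q * ε * c := by positivity
  nlinarith

lemma FlArith.mul_error (fl : FlArith ε) (x y : ℝ) : |fl.mul x y - x * y| ≤ ε * |x * y| := by
  obtain ⟨δ, hδ, he⟩ := fl.mul_spec x y
  rw [he, show x * y * (1 + δ) - x * y = δ * (x * y) by ring, abs_mul]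
  exact mul_le_mul_of_nonneg_right hδ (abs_nonneg _)

lemma FlArith.neg_mul_error (fl : FlArith ε) (x y : ℝ) :
    |-fl.mul x y - -(x * y)| ≤ ε * |-(x * y)| := by
  rw [neg_sub_neg, abs_sub_comm, abs_neg]
  exact fl.mul_error x y

/-- Relative error bound that covers every scalar recurrence with at most `N` products. -/
noncomputable def roundoff (ε : ℝ) (N : ℕ) : ℝ := (1 + ε) ^ (N + 4) - 1

lemma pow_sub_one_le_roundoff (hε : 0 ≤ ε) {k N : ℕ} (h : k ≤ N + 4) :
    (1 + ε) ^ k - 1 ≤ roundoff ε N :=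
  sub_le_sub_right (pow_le_pow_right₀ (by linarith) h) 1

lemma roundoff_nonneg (hε : 0 ≤ ε) (N : ℕ) : 0 ≤ roundoff ε N :=
  sub_nonneg.2 (one_le_pow₀ (by linarith))

/-- Compare `(1 + ε) ^ n` with `exp (n ε)` and use `|exp x - 1| ≤ 2 |x|` for `|x| ≤ 1`. -/
lemma roundoff_le (hε : 0 ≤ ε) {N : ℕ} (h : (N + 4 : ℝ) * ε ≤ 1) :
    roundoff ε N ≤ 2 * (N + 4) * ε := by
  have h1 : (1 + ε) ^ (N + 4) ≤ Real.exp ((N + 4 : ℝ) * ε) := by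
    have := pow_le_pow_left₀ (by linarith) (Real.add_one_le_exp ε) (N + 4)
    rw [← Real.exp_nat_mul] at this
    push_cast at this
    rwa [add_comm] at this
  have h2 := Real.abs_exp_sub_one_le (x := (N + 4 : ℝ) * ε) (by rw [abs_of_nonneg (by positivity)]; exact h)
  rw [abs_of_nonneg (a := (N + 4 : ℝ) * ε) (by positivity)] at h2
  have h3 := le_abs_self (Real.exp ((N + 4 : ℝ) * ε) - 1)
  unfold roundoff
  linarith

lemma FlSum.error_sub (hε : 0 ≤ ε) {τ : Type*} {t : Finset τ} {c : ℝ} {a b : τ → ℝ} {z : ℝ}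
    (hz : FlSum fl (c ::ₘ t.val.map fun l => -fl.mul (a l) (b l)) z) :
    |z - (c - ∑ l ∈ t, a l * b l)| ≤
      ((1 + ε) ^ (t.card + 2) - 1) * (|c| + ∑ l ∈ t, |a l * b l|) := by
  rw [← Multiset.singleton_add] at hz
  have := hz.error_of_terms hε t {c} (fun l => fl.neg_mul_error (a l) (b l))
  simp only [Multiset.sum_singleton, Finset.sum_neg_distrib, Multiset.card_singleton,
    Multiset.map_singleton, abs_neg, ← sub_eq_add_neg] at this
  rwa [show 1 + t.card + 1 = t.card + 2 by ring] at this

lemma FlSum.error_add (hε : 0 ≤ ε) {τ : Type*} {t : Finset τ} {c : ℝ} {a b : τ → ℝ} {z : ℝ}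
    (hz : FlSum fl (c ::ₘ t.val.map fun l => fl.mul (a l) (b l)) z) :
    |z - (c + ∑ l ∈ t, a l * b l)| ≤
      ((1 + ε) ^ (t.card + 2) - 1) * (|c| + ∑ l ∈ t, |a l * b l|) := by
  rw [← Multiset.singleton_add] at hz
  have := hz.error_of_terms hε t {c} (fun l => fl.mul_error (a l) (b l))
  simp only [Multiset.sum_singleton, Multiset.card_singleton, Multiset.map_singleton] at this
  rwa [show 1 + t.card + 1 = t.card + 2 by ring] at this

lemma FlSum.error_mul (hε : 0 ≤ ε) {τ : Type*} {t : Finset τ} {a b : τ → ℝ} {z : ℝ}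
    (hz : FlSum fl (t.val.map fun l => fl.mul (a l) (b l)) z) :
    |z - ∑ l ∈ t, a l * b l| ≤ ((1 + ε) ^ (t.card + 1) - 1) * ∑ l ∈ t, |a l * b l| := by
  rw [← zero_add (t.val.map _)] at hz
  have := hz.error_of_terms hε t 0 (fun l => fl.mul_error (a l) (b l))
  simpa using this

/-- Residual of a recurrence `w ≈ c - ∑ a b` when `w` is the computed right-hand side up to a
further relative error. -/
lemma FlSum.residual_sub (hε : 0 ≤ ε) {τ : Type*} {t : Finset τ} {c : ℝ} {a b : τ → ℝ} {z w : ℝ}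
    (hz : FlSum fl (c ::ₘ t.val.map fun l => -fl.mul (a l) (b l)) z) {r : ℕ}
    (hw : |w - z| ≤ ((1 + ε) ^ r - 1) * |z|) :
    |(∑ l ∈ t, a l * b l) + w - c| ≤
      ((1 + ε) ^ (t.card + 2 + r) - 1) * (|c| + ∑ l ∈ t, |a l * b l|) := by
  have h1 := hz.error_sub hε
  have hr : 1 ≤ (1 + ε) ^ r := one_le_pow₀ (by linarith)
  have hq : 1 ≤ (1 + ε) ^ (t.card + 2) := one_le_pow₀ (by linarith)
  rw [pow_add (1 + ε) (t.card + 2) r]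
  set q := (1 + ε) ^ (t.card + 2)
  set e := (1 + ε) ^ r
  have h2 : |∑ l ∈ t, a l * b l| ≤ ∑ l ∈ t, |a l * b l| := Finset.abs_sum_le_sum_abs _ _
  set S := ∑ l ∈ t, a l * b l
  set H := ∑ l ∈ t, |a l * b l|
  have h3 : |z| ≤ q * (|c| + H) := by
    have h4 := abs_add_le (z - (c - S)) (c - S)
    rw [sub_add_cancel] at h4
    have h5 := abs_sub c S
    linarith
  have h4 := abs_add_le (z - (c - S)) (w - z)
  rw [show z - (c - S) + (w - z) = S + w - c by ring] at h4
  have h5 := mul_le_mul_of_nonneg_left h3 (sub_nonneg.2 hr)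
  nlinarith

variable {ι κ ν : Type*} [Fintype ι] [Fintype κ] [Fintype ν]
  [DecidableEq ι] [DecidableEq κ] [DecidableEq ν]

lemma FlMul.error (hε : 0 ≤ ε) {N : ℕ} (hι : Fintype.card ι ≤ N) (hκ : Fintype.card κ ≤ N)
    (hν : Fintype.card ν ≤ N) {A : Matrix ι κ ℝ} {B : Matrix κ ν ℝ} {C : Matrix ι ν ℝ}
    (h : FlMul fl A B C) : ‖C - A * B‖ ≤ N * roundoff ε N * (‖A‖ * ‖B‖) := by
  rw [mul_assoc]
  refine norm_le_of_entry_le _ hι hν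
    (mul_nonneg (roundoff_nonneg hε N) (by positivity)) fun i j => ?_
  rw [Matrix.sub_apply, Matrix.mul_apply]
  refine (FlSum.error_mul hε (h i j)).trans ?_
  exact mul_le_mul (pow_sub_one_le_roundoff hε (by simp only [Finset.card_univ]; omega))
    (sum_abs_entries_le A B _ i j) (Finset.sum_nonneg fun _ _ => abs_nonneg _)
    (roundoff_nonneg hε N)

lemma FlAddMul.error (hε : 0 ≤ ε) {N : ℕ} (hι : Fintype.card ι ≤ N) (hκ : Fintype.card κ ≤ N)
    (hν : Fintype.card ν ≤ N) {A : Matrix ι κ ℝ} {B : Matrix κ ν ℝ} {C D : Matrix ι ν ℝ}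
    (h : FlAddMul fl C A B D) :
    ‖D - (C + A * B)‖ ≤ N * roundoff ε N * (‖C‖ + ‖A‖ * ‖B‖) := by
  rw [mul_assoc]
  refine norm_le_of_entry_le _ hι hν
    (mul_nonneg (roundoff_nonneg hε N) (by positivity)) fun i j => ?_
  rw [Matrix.sub_apply, Matrix.add_apply, Matrix.mul_apply]
  refine (FlSum.error_add hε (h i j)).trans ?_
  exact mul_le_mul (pow_sub_one_le_roundoff hε (by simp only [Finset.card_univ]; omega))
    (add_le_add (abs_entry_le C i j) (sum_abs_entries_le A B _ i j))
    (add_nonneg (abs_nonneg _) (Finset.sum_nonneg fun _ _ => abs_nonneg _))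
    (roundoff_nonneg hε N)

lemma FlSubMul.error (hε : 0 ≤ ε) {N : ℕ} (hι : Fintype.card ι ≤ N) (hκ : Fintype.card κ ≤ N)
    (hν : Fintype.card ν ≤ N) {A : Matrix ι κ ℝ} {B : Matrix κ ν ℝ} {C D : Matrix ι ν ℝ}
    (h : FlSubMul fl C A B D) :
    ‖D - (C - A * B)‖ ≤ N * roundoff ε N * (‖C‖ + ‖A‖ * ‖B‖) := by
  rw [mul_assoc]
  refine norm_le_of_entry_le _ hι hν
    (mul_nonneg (roundoff_nonneg hε N) (by positivity)) fun i j => ?_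
  rw [Matrix.sub_apply, Matrix.sub_apply, Matrix.mul_apply]
  refine (FlSum.error_sub hε (h i j)).trans ?_
  exact mul_le_mul (pow_sub_one_le_roundoff hε (by simp only [Finset.card_univ]; omega))
    (add_le_add (abs_entry_le C i j) (sum_abs_entries_le A B _ i j))
    (add_nonneg (abs_nonneg _) (Finset.sum_nonneg fun _ _ => abs_nonneg _))
    (roundoff_nonneg hε N)

lemma FlArith.div_mul_error (fl : FlArith ε) {z y : ℝ} (hy : y ≠ 0) :
    |fl.div z y * y - z| ≤ ((1 + ε) ^ 1 - 1) * |z| := by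
  obtain ⟨δ, hδ, he⟩ := fl.div_spec z y hy
  rw [he, show z / y * (1 + δ) * y - z = δ * z by field_simp; ring, abs_mul]
  have := mul_le_mul_of_nonneg_right hδ (abs_nonneg z)
  linarith

lemma FlArith.sqrt_sq_error (fl : FlArith ε) {z : ℝ} (hz : 0 ≤ z) :
    |fl.sqrt z ^ 2 - z| ≤ ((1 + ε) ^ 2 - 1) * |z| := by
  obtain ⟨δ, hδ, he⟩ := fl.sqrt_spec z hz
  rw [he, mul_pow, Real.sq_sqrt hz, show z * (1 + δ) ^ 2 - z = (2 * δ + δ ^ 2) * z by ring, abs_mul]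
  refine mul_le_mul_of_nonneg_right ?_ (abs_nonneg z)
  have h1 := abs_add_le (2 * δ) (δ ^ 2)
  rw [abs_mul, abs_pow, abs_two] at h1
  have h2 := pow_le_pow_left₀ (abs_nonneg δ) hδ 2
  nlinarith

lemma sum_mul_upper {m s : ℕ} (Z : Matrix (Fin m) (Fin s) ℝ) {L : Matrix (Fin s) (Fin s) ℝ}
    (hL : ∀ i j, j < i → L i j = 0) (i : Fin m) (j : Fin s) :
    (Z * L) i j = (∑ l ∈ Finset.Iio j, Z i l * L l j) + Z i j * L j j := by
  rw [Matrix.mul_apply, ← Finset.sum_subset (Finset.subset_univ (Finset.Iic j)),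
    ← Finset.Iio_insert, Finset.sum_insert (by simp), add_comm]
  intro l _ hl
  rw [hL l j (by simpa using hl), mul_zero]

lemma FlTriSolve.error (hε : 0 ≤ ε) {m s N : ℕ} (hm : m ≤ N) (hs : s ≤ N)
    {V Z : Matrix (Fin m) (Fin s) ℝ} {L : Matrix (Fin s) (Fin s) ℝ}
    (hL : ∀ i j, j < i → L i j = 0) (hd : ∀ j, L j j ≠ 0) (h : FlTriSolve fl V L Z) :
    ‖Z * L - V‖ ≤ N * roundoff ε N * (‖V‖ + ‖Z‖ * ‖L‖) := by
  rw [mul_assoc]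
  refine norm_le_of_entry_le _ (by simpa using hm) (by simpa using hs)
    (mul_nonneg (roundoff_nonneg hε N) (by positivity)) fun i j => ?_
  obtain ⟨z, hz, hZ⟩ := h i j
  rw [Matrix.sub_apply, sum_mul_upper Z hL]
  refine (hz.residual_sub hε (r := 1) ?_).trans ?_
  · rw [hZ]; exact fl.div_mul_error (hd j)
  · refine mul_le_mul (pow_sub_one_le_roundoff hε ?_)
      (add_le_add (abs_entry_le V i j) (sum_abs_entries_le Z L _ i j))
      (add_nonneg (abs_nonneg _) (Finset.sum_nonneg fun _ _ => abs_nonneg _))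
      (roundoff_nonneg hε N)
    have := Finset.card_le_univ (Finset.Iio j)
    simp only [Fintype.card_fin] at this
    omega

end Rounding

/-! ### Floating-point Cholesky: positivity of the pivots and backward error. -/

section Cholesky

/-- Only entries on the supports of `u` and `v` count. This lets the exceptional diagonal entry be
set aside in `FlChol.pivot_pos_of_forall_lt`. -/
lemma abs_bilin_le {ι κ : Type*} [Fintype ι] [Fintype κ] (F : Matrix ι κ ℝ) (u : ι → ℝ) (v : κ → ℝ)
    {e : ℝ} (h : ∀ i j, u i ≠ 0 → v j ≠ 0 → |F i j| ≤ e) :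
    |u ⬝ᵥ F *ᵥ v| ≤ e * ((∑ i, |u i|) * ∑ j, |v j|) := by
  rw [Finset.sum_mul_sum, Finset.mul_sum]
  refine (Finset.abs_sum_le_sum_abs _ _).trans (Finset.sum_le_sum fun i _ => ?_)
  rw [abs_mul, Finset.mul_sum]
  refine (mul_le_mul_of_nonneg_left (Finset.abs_sum_le_sum_abs _ _) (abs_nonneg _)).trans ?_
  rw [Finset.mul_sum]
  refine Finset.sum_le_sum fun j _ => ?_
  rw [abs_mul]
  by_cases hu : u i = 0
  · simp [hu]
  by_cases hv : v j = 0
  · simp [hv]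
  have := mul_le_mul_of_nonneg_right (h i j hu hv)
    (mul_nonneg (abs_nonneg (u i)) (abs_nonneg (v j)))
  linarith

variable {ε : ℝ} {fl : FlArith ε} {s N : ℕ} {A L : Matrix (Fin s) (Fin s) ℝ} {d : Fin s → ℝ}

lemma FlChol.diag_ne_zero (hε : 0 ≤ ε) (h : FlChol fl A L d) (hg : roundoff ε N ≤ 1 / 3)
    {a : Fin s} (ha : 0 < d a) : L a a ≠ 0 := by
  intro h0
  have h1 := fl.sqrt_sq_error ha.le
  rw [← h.diag, h0, abs_of_pos ha] at h1
  have h2 := pow_sub_one_le_roundoff hε (k := 2) (N := N) (by omega)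
  have h3 : |(0 : ℝ) ^ 2 - d a| = d a := by rw [zero_pow two_ne_zero, zero_sub, abs_neg, abs_of_pos ha]
  rw [h3] at h1
  nlinarith

lemma FlChol.gram_eq (h : FlChol fl A L d) {a : Fin s} (b : Fin s) {t : Finset (Fin s)}
    (ht : Finset.Iic a ⊆ t) :
    ∑ l ∈ t, L l a * L l b = (∑ l ∈ Finset.Iio a, L l a * L l b) + L a a * L a b := by
  rw [← Finset.sum_subset ht, ← Finset.Iio_insert, Finset.sum_insert (by simp), add_comm]
  intro l _ hl
  rw [h.lower l a (by simpa using hl), zero_mul]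

/-- Rows of `L` beyond `a` do not touch column `a`, so the sum may run over any `t` containing `Iic
a`: all rows for `Lᵀ L`, or the rows before `j` for a factorization that has only reached column
`j`. -/
lemma FlChol.residual_entry (hε : 0 ≤ ε) (hs : s ≤ N) (h : FlChol fl A L d)
    (hg : roundoff ε N ≤ 1 / 3) {a b : Fin s} (hab : a ≤ b) (ha : 0 < d a) {t : Finset (Fin s)}
    (ht : Finset.Iic a ⊆ t) :
    |(∑ l ∈ t, L l a * L l b) - A a b| ≤
      roundoff ε N * (|A a b| + ∑ l ∈ Finset.Iio a, |L l a * L l b|) := by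
  have hc : (Finset.Iio a).card + 2 + 2 ≤ N + 4 := by
    have := Finset.card_le_univ (Finset.Iio a)
    simp only [Fintype.card_fin] at this
    omega
  have hn : 0 ≤ |A a b| + ∑ l ∈ Finset.Iio a, |L l a * L l b| :=
    add_nonneg (abs_nonneg _) (Finset.sum_nonneg fun _ _ => abs_nonneg _)
  rw [h.gram_eq b ht]
  rcases hab.eq_or_lt with rfl | hlt
  · refine ((h.pivot a).residual_sub hε (r := 2) (w := L a a * L a a) ?_).trans ?_
    · rw [h.diag, ← sq]; exact fl.sqrt_sq_error ha.le
    · exact mul_le_mul_of_nonneg_right (pow_sub_one_le_roundoff hε hc) hn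
  · obtain ⟨z, hz, hL⟩ := h.upper a b hlt
    refine (hz.residual_sub hε (r := 1) (w := L a a * L a b) ?_).trans ?_
    · rw [hL, mul_comm]; exact fl.div_mul_error (h.diag_ne_zero hε hg ha)
    · exact mul_le_mul_of_nonneg_right (pow_sub_one_le_roundoff hε (by omega)) hn

/-- The squared column norm `S` satisfies `S ≤ μ + g (μ + S)`, and `g ≤ 1/3` gives `S ≤ 2 μ`. -/
lemma FlChol.col_sum_sq_le (hε : 0 ≤ ε) (hs : s ≤ N) (h : FlChol fl A L d)
    (hg : roundoff ε N ≤ 1 / 3) {μ : ℝ} (hμ : ∀ a b, |A a b| ≤ μ) {a : Fin s} (ha : 0 < d a) :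
    ∑ l, L l a ^ 2 ≤ 2 * μ := by
  have h1 := h.residual_entry hε hs hg le_rfl ha (Finset.subset_univ _)
  have h2 : ∑ l ∈ Finset.Iio a, |L l a * L l a| ≤ ∑ l, L l a ^ 2 := by
    simp only [← sq, abs_sq]
    exact Finset.sum_le_univ_sum_of_nonneg fun _ => sq_nonneg _
  simp only [← sq] at h1 h2
  have h3 := (abs_le.1 h1).2
  have h4 := hμ a a
  have h5 := le_abs_self (A a a)
  have h6 := roundoff_nonneg hε N
  have h7 : 0 ≤ ∑ l, L l a ^ 2 := Finset.sum_nonneg fun _ _ => sq_nonneg _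
  have h8 := mul_le_mul_of_nonneg_left (add_le_add h4 h2) h6
  have h9 := mul_le_mul_of_nonneg_right hg (add_nonneg ((abs_nonneg _).trans h4) h7)
  nlinarith

/-- The vector along which the part of the factorization computed before column `j` is blind.
Testing the matrix on it isolates the `j`-th pivot without forming a Schur complement. -/
lemma FlChol.exists_null_vector (hε : 0 ≤ ε) (h : FlChol fl A L d)
    (hg : roundoff ε N ≤ 1 / 3) {j : Fin s} (hd : ∀ a < j, 0 < d a) :
    ∃ x : Fin s → ℝ, x j = 1 ∧ (∀ a, j < a → x a = 0) ∧ ∀ a < j, L a ⬝ᵥ x = 0 := by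
  classical
  -- Identity rows from `j` on keep the matrix triangular with nonzero diagonal; the solution of `L'
  -- x = e_j` is the required vector.
  set L' : Matrix (Fin s) (Fin s) ℝ :=
    Matrix.of fun a b => if a < j then L a b else if a = b then 1 else 0 with hL'
  have htri : L'.BlockTriangular id := by
    intro a b hab
    simp only [id] at hab
    simp only [hL', Matrix.of_apply, h.lower a b hab, hab.ne', if_false, ite_self]
  have hdet : L'.det ≠ 0 := by
    rw [Matrix.det_of_isUpperTriangular htri]
    refine Finset.prod_ne_zero_iff.2 fun a _ => ?_
    simp only [hL', Matrix.of_apply, if_true]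
    split_ifs with ha
    · exact h.diag_ne_zero hε hg (hd a ha)
    · exact one_ne_zero
  have hx : L' *ᵥ (L'⁻¹ *ᵥ Pi.single j 1) = Pi.single j 1 := by
    rw [Matrix.mulVec_mulVec, Matrix.mul_nonsing_inv _ (isUnit_iff_ne_zero.2 hdet),
      Matrix.one_mulVec]
  set x := L'⁻¹ *ᵥ Pi.single j 1
  have hge : ∀ a, ¬ a < j → x a = (Pi.single j 1 : Fin s → ℝ) a := by
    intro a ha
    have h1 := congrFun hx a
    rw [← h1, Matrix.mulVec, dotProduct]
    simp [hL', ha]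
  refine ⟨x, by simpa using hge j (lt_irrefl j), fun a ha => ?_, fun a ha => ?_⟩
  · rw [hge a ha.not_gt, Pi.single_eq_of_ne ha.ne']
  · have h1 := congrFun hx a
    rw [Pi.single_eq_of_ne ha.ne] at h1
    rw [← h1, Matrix.mulVec]
    congr 1
    ext b
    simp [hL', ha]

/-- Let `G` be the Gram matrix of the rows before `j`, and `x` the null vector. The form of `G - B`
at `x` is at most `-lam ‖x‖²`, yet on the relevant indices the entries of `G - B` are small except
at `(j, j)`. That entry must therefore be clearly negative, so `B j j` exceeds the squares
subtracted from it, and so does the computed pivot. -/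
lemma FlChol.pivot_pos_of_forall_lt (hε : 0 ≤ ε) (hs : s ≤ N) (h : FlChol fl A L d)
    (hg : roundoff ε N ≤ 1 / 3) {B : Matrix (Fin s) (Fin s) ℝ} (hB : Bᵀ = B) {τ μ lam : ℝ}
    (hτ : ∀ a b, |A a b - B a b| ≤ τ) (hμ : ∀ a b, |A a b| ≤ μ) (hμB : ∀ a b, |B a b| ≤ μ)
    (hlam : 0 < lam) (hpos : ∀ x, lam * vnorm x ^ 2 ≤ x ⬝ᵥ B *ᵥ x)
    (hsmall : 2 * N * (2 * τ + 6 * roundoff ε N * μ) ≤ lam) {j : Fin s}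
    (hd : ∀ a < j, 0 < d a) : 0 < d j := by
  obtain ⟨x, hxj, hxgt, hx⟩ := h.exists_null_vector hε hg hd
  set g := roundoff ε N
  have hg0 : 0 ≤ g := roundoff_nonneg hε N
  have hτ0 : 0 ≤ τ := (abs_nonneg _).trans (hτ j j)
  have hμ0 : 0 ≤ μ := (abs_nonneg _).trans (hμ j j)
  have hN : (1 : ℝ) ≤ N := by
    have := j.isLt
    exact_mod_cast (by omega : 1 ≤ N)
  -- No bound on this quantity is known yet: `FlChol.col_sum_sq_le` for column `j` would need the
  -- positivity being proved. It stays in the estimates and is absorbed at the end.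
  set rho2 := ∑ l ∈ Finset.Iio j, L l j ^ 2 with hrho2
  have hrho0 : 0 ≤ rho2 := Finset.sum_nonneg fun _ _ => sq_nonneg _
  set rho := Real.sqrt rho2
  have hrho : rho ^ 2 = rho2 := Real.sq_sqrt hrho0
  set σ := Real.sqrt (2 * μ)
  have hσ : σ ^ 2 = 2 * μ := Real.sq_sqrt (by positivity)
  set G : Matrix (Fin s) (Fin s) ℝ :=
    Matrix.of fun a b => ∑ l ∈ Finset.Iio j, L l a * L l b with hG
  have hIic : ∀ a, a < j → Finset.Iic a ⊆ Finset.Iio j := fun a ha l hl =>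
    Finset.mem_Iio.2 ((Finset.mem_Iic.1 hl).trans_lt ha)
  have hGsymm : ∀ a b, G a b = G b a := fun a b => by
    simp only [hG, Matrix.of_apply, mul_comm]
  have hBsymm : ∀ a b, B a b = B b a := fun a b => congrFun (congrFun hB b) a
  -- entries left of column `j`
  have hcol : ∀ a, a < j → ∑ l ∈ Finset.Iio a, L l a ^ 2 ≤ σ ^ 2 := fun a ha => by
    rw [hσ]
    exact (Finset.sum_le_univ_sum_of_nonneg fun _ => sq_nonneg _).trans
      (h.col_sum_sq_le hε hs hg hμ (hd a ha))
  have hsub : ∀ a b, |G a b - B a b| ≤ |G a b - A a b| + τ := fun a b => by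
    have := abs_sub_le (G a b) (A a b) (B a b)
    linarith [hτ a b]
  have hF1' : ∀ a b, a ≤ b → b < j → |G a b - B a b| ≤ τ + 3 * g * μ := by
    intro a b hab hb
    have ha := hab.trans_lt hb
    have h1 := h.residual_entry hε hs hg hab (hd a ha) (hIic a ha)
    have h2 : ∑ l ∈ Finset.Iio a, |L l a * L l b| ≤ σ * σ := by
      refine sum_abs_mul_le _ _ _ (Real.sqrt_nonneg _) (Real.sqrt_nonneg _) (hcol a ha) ?_
      exact (Finset.sum_le_sum_of_subset_of_nonneg (Finset.Iio_subset_Iio hab)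
        fun _ _ _ => sq_nonneg _).trans (hcol b hb)
    have h3 := mul_le_mul_of_nonneg_left (add_le_add (hμ a b) h2) hg0
    have h4 := hsub a b
    simp only [hG, Matrix.of_apply] at h4 ⊢
    nlinarith
  have hF1 : ∀ a b, a < j → b < j → |G a b - B a b| ≤ τ + 3 * g * μ := by
    intro a b ha hb
    rcases le_total a b with hab | hab
    · exact hF1' a b hab hb
    · rw [hGsymm, hBsymm]; exact hF1' b a hab ha
  have hF2 : ∀ a, a < j → |G a j - B a j| ≤ τ + g * μ + g * (σ * rho) := by
    intro a ha
    have h1 := h.residual_entry hε hs hg ha.le (hd a ha) (hIic a ha)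
    have h2 : ∑ l ∈ Finset.Iio a, |L l a * L l j| ≤ σ * rho := by
      refine sum_abs_mul_le _ _ _ (Real.sqrt_nonneg _) (Real.sqrt_nonneg _) (hcol a ha) ?_
      rw [hrho]
      exact Finset.sum_le_sum_of_subset_of_nonneg (Finset.Iio_subset_Iio ha.le)
        fun _ _ _ => sq_nonneg _
    have h3 := mul_le_mul_of_nonneg_left (add_le_add (hμ a j) h2) hg0
    have h4 := hsub a j
    simp only [hG, Matrix.of_apply] at h4 ⊢
    nlinarith
  -- the quadratic form of `G` vanishes at `x`
  have hGx : x ⬝ᵥ G *ᵥ x = 0 := by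
    have h1 : G *ᵥ x = 0 := by
      ext a
      simp only [Matrix.mulVec, dotProduct, hG, Matrix.of_apply, Finset.sum_mul, mul_assoc]
      rw [Finset.sum_comm]
      refine Finset.sum_eq_zero fun l hl => ?_
      rw [← Finset.mul_sum]
      exact mul_eq_zero_of_right _ (hx l (Finset.mem_Iio.1 hl))
    rw [h1, dotProduct_zero]
  set e : Fin s → ℝ := Pi.single j 1
  set y : Fin s → ℝ := x - e with hy
  have hyj : ∀ a, ¬ a < j → y a = 0 := by
    intro a ha
    rcases (not_lt.1 ha).eq_or_lt with rfl | h1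
    · simp [hy, e, hxj]
    · simp [hy, e, hxgt a h1, h1.ne']
  have hxy : x = y + e := by simp [hy]
  have hnorm : vnorm x ^ 2 = vnorm y ^ 2 + 1 := by
    rw [hxy, vnorm_sq, vnorm_sq]
    simp [e, add_dotProduct, dotProduct_add, hyj j (lt_irrefl j)]
  set F := G - B with hF
  have hFx : x ⬝ᵥ F *ᵥ x ≤ -(lam * vnorm x ^ 2) := by
    rw [hF, Matrix.sub_mulVec, dotProduct_sub, hGx]
    linarith [hpos x]
  have hsplit : x ⬝ᵥ F *ᵥ x = y ⬝ᵥ F *ᵥ y + y ⬝ᵥ F *ᵥ e + e ⬝ᵥ F *ᵥ y + F j j := by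
    rw [hxy]
    simp only [Matrix.mulVec_add, add_dotProduct, dotProduct_add]
    have : e ⬝ᵥ F *ᵥ e = F j j := by simp [e]
    rw [this]
    ring
  set t := ∑ i, |y i| with ht
  have ht0 : 0 ≤ t := Finset.sum_nonneg fun _ _ => abs_nonneg _
  have hesum : ∑ i, |e i| = 1 := by
    rw [Finset.sum_eq_single j] <;> simp +contextual [e]
  have he_supp : ∀ a, e a ≠ 0 → a = j := by
    intro a ha
    by_contra hne
    exact ha (by simp [e, hne])
  have hy_supp : ∀ a, y a ≠ 0 → a < j := fun a ha => not_not.1 fun h' => ha (hyj a h')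
  have hyy : |y ⬝ᵥ F *ᵥ y| ≤ (τ + 3 * g * μ) * (t * t) :=
    abs_bilin_le F y y fun a b ha hb => hF1 a b (hy_supp a ha) (hy_supp b hb)
  have hye : |y ⬝ᵥ F *ᵥ e| ≤ (τ + g * μ + g * (σ * rho)) * (t * 1) := by
    rw [← hesum]
    refine abs_bilin_le F y e fun a b ha hb => ?_
    rw [he_supp b hb]
    exact hF2 a (hy_supp a ha)
  have hey : |e ⬝ᵥ F *ᵥ y| ≤ (τ + g * μ + g * (σ * rho)) * (1 * t) := by
    rw [← hesum]
    refine abs_bilin_le F e y fun a b ha hb => ?_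
    rw [he_supp a ha, hF, Matrix.sub_apply, hGsymm, hBsymm]
    exact hF2 b (hy_supp b hb)
  have hFjj : F j j = rho2 - B j j := by
    simp [hF, hG, hrho2, sq]
  have htN : t ^ 2 ≤ N * vnorm y ^ 2 := sum_abs_le_vnorm y (by simpa using hs)
  have hgμ : 0 ≤ g * μ := mul_nonneg hg0 hμ0
  -- The arithmetic-geometric mean inequality splits the unknown `rho` from `t`, at the price of `g
  -- * rho2` in `key`.
  have ham1 : 2 * (σ * rho) * t ≤ 2 * μ * t ^ 2 + rho2 := by
    nlinarith [sq_nonneg (σ * t - rho)]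
  have ham2 : 2 * t ≤ t ^ 2 + 1 := by nlinarith [sq_nonneg (t - 1)]
  -- Of the five copies of `g * μ`, two pay for `g * rho2` once `rho2 ≤ 2 * μ` is known, and three
  -- for the rounding of the pivot itself.
  have key : lam / 2 + (τ + 5 * (g * μ)) + rho2 - g * rho2 ≤ B j j := by
    have h1 := (abs_le.1 hyy).1
    have h2 := (abs_le.1 hye).1
    have h3 := (abs_le.1 hey).1
    have h4 := mul_le_mul_of_nonneg_left ham1 hg0
    have h5 := mul_le_mul_of_nonneg_left ham2 (add_nonneg hτ0 hgμ)
    have h6 := mul_le_mul_of_nonneg_left htN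
      (show 0 ≤ 2 * τ + 6 * (g * μ) by positivity)
    have h7 := mul_le_mul_of_nonneg_right hsmall (sq_nonneg (vnorm y))
    have h8 : 2 * τ + 6 * (g * μ) ≤ lam / 2 := by
      have := mul_le_mul_of_nonneg_right hN (show 0 ≤ 2 * τ + 6 * (g * μ) by positivity)
      linarith
    rw [hnorm] at hFx
    linarith [mul_nonneg hlam.le (sq_nonneg (vnorm y))]
  have hBμ := (le_abs_self _).trans (hμB j j)
  have hgr : g * rho2 ≤ 1 / 3 * rho2 := mul_le_mul_of_nonneg_right hg hrho0
  have hrhoμ : rho2 ≤ 2 * μ := by linarith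
  have hp := (h.pivot j).error_sub hε
  simp only [← sq, abs_sq] at hp
  rw [← hrho2] at hp
  have hp2 : ((1 + ε) ^ ((Finset.Iio j).card + 2) - 1) * (|A j j| + rho2) ≤ g * (μ + 2 * μ) := by
    refine mul_le_mul (pow_sub_one_le_roundoff hε ?_) (add_le_add (hμ j j) hrhoμ)
      (add_nonneg (abs_nonneg _) hrho0) hg0
    have := Finset.card_le_univ (Finset.Iio j)
    simp only [Fintype.card_fin] at this
    omega
  have h1 := (abs_le.1 hp).1
  have h2 := (abs_le.1 (hτ j j)).1
  have h3 := mul_le_mul_of_nonneg_left hrhoμ hg0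
  linarith

lemma FlChol.pivot_pos (hε : 0 ≤ ε) (hs : s ≤ N) (h : FlChol fl A L d)
    (hg : roundoff ε N ≤ 1 / 3) {B : Matrix (Fin s) (Fin s) ℝ} (hB : Bᵀ = B) {τ μ lam : ℝ}
    (hτ : ∀ a b, |A a b - B a b| ≤ τ) (hμ : ∀ a b, |A a b| ≤ μ) (hμB : ∀ a b, |B a b| ≤ μ)
    (hlam : 0 < lam) (hpos : ∀ x, lam * vnorm x ^ 2 ≤ x ⬝ᵥ B *ᵥ x)
    (hsmall : 2 * N * (2 * τ + 6 * roundoff ε N * μ) ≤ lam) (j : Fin s) : 0 < d j := by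
  induction j using WellFoundedLT.induction with
  | ind j ih => exact h.pivot_pos_of_forall_lt hε hs hg hB hτ hμ hμB hlam hpos hsmall ih

/-- The factorization reads only the upper triangle of `A`, which need not be symmetric. The
entrywise bounds are transferred to the lower triangle by the symmetry of `B`. -/
lemma FlChol.norm_gram_sub_le (hε : 0 ≤ ε) (hs : s ≤ N) (h : FlChol fl A L d)
    (hg : roundoff ε N ≤ 1 / 3) {B : Matrix (Fin s) (Fin s) ℝ} (hB : Bᵀ = B) {τ μ : ℝ}
    (hτ0 : 0 ≤ τ) (hμ0 : 0 ≤ μ)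
    (hτ : ∀ a b, |A a b - B a b| ≤ τ) (hμ : ∀ a b, |A a b| ≤ μ) (hd : ∀ j, 0 < d j) :
    ‖Lᵀ * L - B‖ ≤ N * (τ + 3 * roundoff ε N * μ) := by
  have hg0 := roundoff_nonneg hε N
  have key : ∀ a b, a ≤ b → |(Lᵀ * L - B) a b| ≤ τ + 3 * roundoff ε N * μ := by
    intro a b hab
    have h1 := h.residual_entry hε hs hg hab (hd a) (Finset.subset_univ _)
    have hσ : Real.sqrt (2 * μ) ^ 2 = 2 * μ := Real.sq_sqrt (by positivity)
    have hcol : ∀ c, ∑ l ∈ Finset.Iio a, L l c ^ 2 ≤ Real.sqrt (2 * μ) ^ 2 := fun c => by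
      rw [hσ]
      exact (Finset.sum_le_univ_sum_of_nonneg fun _ => sq_nonneg _).trans
        (h.col_sum_sq_le hε hs hg hμ (hd c))
    have h2 := sum_abs_mul_le _ _ _ (Real.sqrt_nonneg (2 * μ)) (Real.sqrt_nonneg (2 * μ))
      (hcol a) (hcol b)
    have h3 := mul_le_mul_of_nonneg_left (add_le_add (hμ a b) h2) hg0
    have h4 := abs_sub_le (∑ l, L l a * L l b) (A a b) (B a b)
    rw [Matrix.sub_apply, Matrix.mul_apply]
    simp only [Matrix.transpose_apply]
    have := hτ a b
    nlinarith
  refine norm_le_of_entry_le _ (by simpa using hs) (by simpa using hs) (by positivity) fun a b => ?_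
  rcases le_total a b with hab | hab
  · exact key a b hab
  · have hsymm : (Lᵀ * L - B)ᵀ = Lᵀ * L - B := by
      rw [Matrix.transpose_sub, hB, Matrix.transpose_mul, Matrix.transpose_transpose]
    rw [← hsymm, Matrix.transpose_apply]
    exact key b a hab

end Cholesky

/-! ### Analysis of one computed projection step. -/

section Step

lemma norm_le_of_sub_le {E : Type*} [SeminormedAddCommGroup E] {u v : E} {a b : ℝ}
    (h : ‖u - v‖ ≤ a) (hv : ‖v‖ ≤ b) : ‖u‖ ≤ b + a :=
  (norm_le_norm_add_norm_sub' u v).trans (add_le_add hv h)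

lemma norm_add_le_of_eq {E : Type*} [SeminormedAddCommGroup E] {u v w : E} {a b : ℝ}
    (h : u = v + w) (hv : ‖v‖ ≤ a) (hw : ‖w‖ ≤ b) : ‖u‖ ≤ a + b :=
  h ▸ norm_add_le_of_le hv hw

section Algebra

variable {ι κ ν : Type*} [Fintype ι] [Fintype κ] [Fintype ν]
  [DecidableEq ι] [DecidableEq κ] [DecidableEq ν]

lemma norm_gram_sub_gram_le {A B : Matrix ι κ ℝ} {a b e : ℝ} (hA : ‖A‖ ≤ a) (hB : ‖B‖ ≤ b)
    (h : ‖A - B‖ ≤ e) : ‖Aᵀ * A - Bᵀ * B‖ ≤ a * e + e * b := by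
  refine norm_add_le_of_eq (v := Aᵀ * (A - B)) (w := (A - B)ᵀ * B) ?_
    (norm_mul_le_of_le (norm_transpose_le hA) h) (norm_mul_le_of_le (norm_transpose_le h) hB)
  simp only [Matrix.mul_sub, Matrix.transpose_sub, Matrix.sub_mul]
  abel

lemma abs_quadratic_le (A : Matrix κ κ ℝ) (v : κ → ℝ) : |v ⬝ᵥ A *ᵥ v| ≤ ‖A‖ * vnorm v ^ 2 := by
  have h1 := abs_dotProduct_le v (A *ᵥ v)
  have h2 := mul_le_mul_of_nonneg_left (vnorm_mulVec_le A v) (vnorm_nonneg v)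
  nlinarith

lemma vnorm_mulVec_sq_eq (A : Matrix ι κ ℝ) (v : κ → ℝ) :
    vnorm (A *ᵥ v) ^ 2 = v ⬝ᵥ (Aᵀ * A) *ᵥ v := by
  rw [vnorm_sq, ← Matrix.mulVec_mulVec, Matrix.dotProduct_mulVec v, Matrix.vecMul_transpose]

lemma norm_le_two_of_gram (Q : Matrix ι κ ℝ) {ω : ℝ} (h : ‖1 - Qᵀ * Q‖ ≤ ω) (hω : ω ≤ 3) :
    ‖Q‖ ≤ 2 := by
  have h1 : ‖Qᵀ * Q‖ ≤ 1 + ω := by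
    refine norm_le_of_sub_le (v := 1) ?_ norm_one_le
    rw [norm_sub_rev]; exact h
  rw [norm_transpose_mul_self] at h1
  nlinarith [norm_nonneg Q]

/-- The Gram matrix of the projected block against the Schur complement. -/
lemma gram_proj_eq (Q : Matrix ι κ ℝ) (Y : Matrix ι ν ℝ) :
    Yᵀ * Y - (Qᵀ * Y)ᵀ * (Qᵀ * Y) = (Y - Q * (Qᵀ * Y))ᵀ * (Y - Q * (Qᵀ * Y)) +
      (Qᵀ * Y)ᵀ * ((1 - Qᵀ * Q) * (Qᵀ * Y)) := by
  simp only [Matrix.transpose_sub, Matrix.transpose_mul, Matrix.transpose_transpose,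
    Matrix.sub_mul, Matrix.mul_sub, Matrix.mul_assoc, Matrix.one_mul]
  abel

lemma schur_symm (Q : Matrix ι κ ℝ) (Y : Matrix ι ν ℝ) :
    (Yᵀ * Y - (Qᵀ * Y)ᵀ * (Qᵀ * Y))ᵀ = Yᵀ * Y - (Qᵀ * Y)ᵀ * (Qᵀ * Y) := by
  simp only [Matrix.transpose_sub, Matrix.transpose_mul, Matrix.transpose_transpose]

end Algebra

variable {ε : ℝ} {fl : FlArith ε} {m s N : ℕ} {κ : Type} [Fintype κ] [DecidableEq κ]
  {Q : Matrix (Fin m) κ ℝ} {Y : Matrix (Fin m) (Fin s) ℝ}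

/-- Hypotheses of the analysis of one computed BCGS-PIP step: `ω` bounds the loss of orthogonality
of `Q`, `α` and `β` bound `Y` and `Qᵀ Y`, and `σ` bounds from below the distance of `Y` to the range
of `Q`. -/
structure StepHyp (ε : ℝ) (N : ℕ) (Q : Matrix (Fin m) κ ℝ) (Y : Matrix (Fin m) (Fin s) ℝ)
    (ω α β σ h ζ : ℝ) : Prop where
  eps_nonneg : 0 ≤ ε
  rows : m ≤ N
  cols : s ≤ N
  prev : Fintype.card κ ≤ N
  pos : 1 ≤ N
  unit : N * roundoff ε N ≤ h
  unit_mul : N * h ≤ ζ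
  orth : ‖1 - Qᵀ * Q‖ ≤ ω
  orth_le : ω ≤ 1 / 2
  norm_Y : ‖Y‖ ≤ α
  norm_coef : ‖Qᵀ * Y‖ ≤ β
  sep : ∀ v w, σ * vnorm v ≤ vnorm (Y *ᵥ v - Q *ᵥ w)
  sep_pos : 0 < σ
  sep_le : σ ≤ α
  small : 10000 * (ζ * α ^ 2 + ω * β ^ 2) ≤ σ ^ 2

namespace StepHyp

variable {ω α β σ h ζ : ℝ}

section

variable (H : StepHyp ε N Q Y ω α β σ h ζ)
include H

lemma alpha_pos : 0 < α := H.sep_pos.trans_le H.sep_le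
lemma omega_nonneg : 0 ≤ ω := (norm_nonneg _).trans H.orth
lemma roundoff_le_unit : roundoff ε N ≤ h := by
  have h1 : (1 : ℝ) ≤ N := by exact_mod_cast H.pos
  have := mul_le_mul_of_nonneg_right h1 (roundoff_nonneg H.eps_nonneg N)
  linarith [H.unit]
lemma unit_nonneg : 0 ≤ h := (roundoff_nonneg H.eps_nonneg N).trans H.roundoff_le_unit
lemma unit_le : h ≤ ζ := by
  have h1 : (1 : ℝ) ≤ N := by exact_mod_cast H.pos
  have := mul_le_mul_of_nonneg_right h1 H.unit_nonneg
  linarith [H.unit_mul]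
lemma zeta_nonneg : 0 ≤ ζ := H.unit_nonneg.trans H.unit_le
lemma zeta_small : 10000 * (ζ * α ^ 2) ≤ σ ^ 2 := by
  have := mul_nonneg H.omega_nonneg (sq_nonneg β)
  linarith [H.small]
lemma omega_small : 10000 * (ω * β ^ 2) ≤ σ ^ 2 := by
  have := mul_nonneg H.zeta_nonneg (sq_nonneg α)
  linarith [H.small]
lemma zeta_le : ζ ≤ 1 / 10000 := by
  have h1 := H.zeta_small
  have h2 : σ ^ 2 ≤ α ^ 2 := pow_le_pow_left₀ H.sep_pos.le H.sep_le 2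
  have h3 : 0 < α ^ 2 := pow_pos H.alpha_pos 2
  by_contra hc
  nlinarith
lemma unit_small : h ≤ 1 / 10000 := H.unit_le.trans H.zeta_le
/-- The unit error is small relative to `σ / α`. -/
lemma unit_mul_le : 10000 * (h * α) ≤ σ := by
  have h1 := H.zeta_small
  have h2 := mul_le_mul_of_nonneg_right H.unit_le (sq_nonneg α)
  have h3 := mul_le_mul_of_nonneg_left H.sep_le H.sep_pos.le
  have h4 := H.alpha_pos
  have h5 : (10000 * (h * α)) * α ≤ σ * α := by nlinarith
  exact le_of_mul_le_mul_right h5 h4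
lemma norm_Q : ‖Q‖ ≤ 2 := norm_le_two_of_gram Q H.orth (by linarith [H.orth_le])
lemma norm_Qt : ‖Qᵀ‖ ≤ 2 := norm_transpose_le H.norm_Q
lemma norm_coef_le : ‖Qᵀ * Y‖ ≤ 2 * α := norm_mul_le_of_le H.norm_Qt H.norm_Y

lemma norm_defect_le : ‖(Qᵀ * Y)ᵀ * ((1 - Qᵀ * Q) * (Qᵀ * Y))‖ ≤ ω * β ^ 2 :=
  (norm_mul_le_of_le (norm_transpose_le H.norm_coef)
    (norm_mul_le_of_le H.orth H.norm_coef)).trans_eq (by ring)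

/-- By `gram_proj_eq` the Schur complement is the Gram matrix of `Y - Q Qᵀ Y`, bounded below by
`sep` at `w = Qᵀ Y v`, plus a defect of norm at most `ω β²`. -/
lemma schur_lower (v : Fin s → ℝ) : (σ ^ 2 - ω * β ^ 2) * vnorm v ^ 2 ≤
    v ⬝ᵥ (Yᵀ * Y - (Qᵀ * Y)ᵀ * (Qᵀ * Y)) *ᵥ v := by
  rw [gram_proj_eq, Matrix.add_mulVec, dotProduct_add, ← vnorm_mulVec_sq_eq]
  have h1 := H.sep v ((Qᵀ * Y) *ᵥ v)
  rw [Matrix.mulVec_mulVec, ← Matrix.sub_mulVec] at h1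
  have h2 := pow_le_pow_left₀ (mul_nonneg H.sep_pos.le (vnorm_nonneg v)) h1 2
  have h3 := (abs_le.1 (abs_quadratic_le ((Qᵀ * Y)ᵀ * ((1 - Qᵀ * Q) * (Qᵀ * Y))) v)).1
  have h4 := mul_le_mul_of_nonneg_right H.norm_defect_le (sq_nonneg (vnorm v))
  rw [mul_pow] at h2
  linarith

lemma norm_schur_exact_le : ‖Yᵀ * Y - (Qᵀ * Y)ᵀ * (Qᵀ * Y)‖ ≤ 5 * α ^ 2 := by
  rw [sub_eq_add_neg]
  refine (norm_add_le _ _).trans ?_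
  rw [norm_neg, norm_transpose_mul_self, norm_transpose_mul_self]
  have h1 := pow_le_pow_left₀ (norm_nonneg _) H.norm_Y 2
  have h2 := pow_le_pow_left₀ (norm_nonneg _) H.norm_coef_le 2
  nlinarith

variable (st : PIPStep fl Q Y)

lemma coef_error : ‖st.coef - Qᵀ * Y‖ ≤ 2 * (h * α) := by
  refine (FlMul.error H.eps_nonneg H.prev (by simpa using H.rows) (by simpa using H.cols)
    st.coef_spec).trans ?_
  have h1 := mul_le_mul H.norm_Qt H.norm_Y (norm_nonneg _) zero_le_two
  have h2 := mul_le_mul H.unit h1 (mul_nonneg (norm_nonneg _) (norm_nonneg _)) H.unit_nonneg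
  linarith

lemma norm_coef_fl : ‖st.coef‖ ≤ 3 * α := by
  refine (norm_le_of_sub_le (H.coef_error st) H.norm_coef_le).trans ?_
  have := mul_le_mul_of_nonneg_right H.unit_small H.alpha_pos.le
  linarith [H.alpha_pos]

lemma gram_error : ‖st.gram - Yᵀ * Y‖ ≤ h * α ^ 2 := by
  refine (FlMul.error H.eps_nonneg (by simpa using H.cols) (by simpa using H.rows)
    (by simpa using H.cols) st.gram_spec).trans ?_
  have h1 := mul_le_mul (norm_transpose_le H.norm_Y) H.norm_Y (norm_nonneg _) H.alpha_pos.le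
  have h2 := mul_le_mul H.unit h1 (mul_nonneg (norm_nonneg _) (norm_nonneg _)) H.unit_nonneg
  linarith

lemma schur_error : ‖st.schur - (Yᵀ * Y - (Qᵀ * Y)ᵀ * (Qᵀ * Y))‖ ≤ 22 * (h * α ^ 2) := by
  have hα := H.alpha_pos
  have hh := H.unit_nonneg
  have h0 : h * α ^ 2 ≤ 1 / 10000 * α ^ 2 :=
    mul_le_mul_of_nonneg_right H.unit_small (sq_nonneg α)
  have hgram : ‖st.gram‖ ≤ 2 * α ^ 2 := by
    refine (norm_le_of_sub_le (H.gram_error st) (b := α ^ 2) ?_).trans (by nlinarith)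
    rw [norm_transpose_mul_self]
    exact pow_le_pow_left₀ (norm_nonneg _) H.norm_Y 2
  have hc := H.norm_coef_fl st
  have h1 : ‖st.schur - (st.gram - st.coefᵀ * st.coef)‖ ≤ 11 * (h * α ^ 2) := by
    refine (FlSubMul.error H.eps_nonneg (by simpa using H.cols) H.prev
      (by simpa using H.cols) st.schur_spec).trans ?_
    have h1 := mul_le_mul (norm_transpose_le hc) hc (norm_nonneg _) (by positivity)
    have h2 := mul_le_mul H.unit (add_le_add hgram h1)
      (add_nonneg (norm_nonneg _) (mul_nonneg (norm_nonneg _) (norm_nonneg _))) hh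
    linarith
  have h2 := norm_gram_sub_gram_le hc H.norm_coef_le (H.coef_error st)
  have h3 := norm_add_le_of_eq (u := (st.gram - st.coefᵀ * st.coef) -
    (Yᵀ * Y - (Qᵀ * Y)ᵀ * (Qᵀ * Y))) (v := st.gram - Yᵀ * Y)
    (w := -(st.coefᵀ * st.coef - (Qᵀ * Y)ᵀ * (Qᵀ * Y))) (by abel) (H.gram_error st)
    ((norm_neg _).trans_le h2)
  have h4 := norm_add_le_of_eq (u := st.schur - (Yᵀ * Y - (Qᵀ * Y)ᵀ * (Qᵀ * Y)))
    (v := st.schur - (st.gram - st.coefᵀ * st.coef)) (w := (st.gram - st.coefᵀ * st.coef) -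
    (Yᵀ * Y - (Qᵀ * Y)ᵀ * (Qᵀ * Y))) (by abel) h1 h3
  linarith

lemma schur_entry_le (a b : Fin s) : |st.schur a b| ≤ 6 * α ^ 2 := by
  refine (abs_entry_le _ a b).trans
    ((norm_le_of_sub_le (H.schur_error st) H.norm_schur_exact_le).trans ?_)
  have := mul_le_mul_of_nonneg_right H.unit_small (sq_nonneg α)
  linarith [sq_nonneg α]

lemma roundoff_le_third : roundoff ε N ≤ 1 / 3 := by
  linarith [H.roundoff_le_unit, H.unit_small]

lemma schur_entry_error (a b : Fin s) :
    |st.schur a b - (Yᵀ * Y - (Qᵀ * Y)ᵀ * (Qᵀ * Y)) a b| ≤ 22 * (h * α ^ 2) :=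
  (abs_entry_le (st.schur - (Yᵀ * Y - (Qᵀ * Y)ᵀ * (Qᵀ * Y))) a b).trans (H.schur_error st)

/-- The computed step does not break down. -/
lemma succeeds : st.Succeeds := by
  have hα2 := sq_nonneg α
  have hσ2 : 0 < σ ^ 2 := pow_pos H.sep_pos 2
  have h1 := H.omega_small
  refine st.fac_spec.pivot_pos H.eps_nonneg H.cols H.roundoff_le_third (schur_symm Q Y)
    (H.schur_entry_error st) (H.schur_entry_le st) (fun a b => ?_)
    (lam := σ ^ 2 - ω * β ^ 2) (by linarith) H.schur_lower ?_
  · exact ((abs_entry_le _ a b).trans H.norm_schur_exact_le).trans (by linarith)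
  -- The perturbation term amounts to at most `160 * (ζ * α ^ 2)`, a small fraction of `σ ^ 2`.
  · have h2 := H.zeta_small
    have h3 := mul_le_mul_of_nonneg_right H.unit_mul hα2
    have h4 := mul_le_mul_of_nonneg_right H.roundoff_le_unit
      (mul_nonneg (Nat.cast_nonneg (α := ℝ) N) hα2)
    have h5 := mul_nonneg H.zeta_nonneg hα2
    nlinarith

lemma fac_gram_error :
    ‖st.facᵀ * st.fac - (Yᵀ * Y - (Qᵀ * Y)ᵀ * (Qᵀ * Y))‖ ≤ 40 * (ζ * α ^ 2) := by
  have hα2 := sq_nonneg α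
  have hh := H.unit_nonneg
  refine (st.fac_spec.norm_gram_sub_le H.eps_nonneg H.cols H.roundoff_le_third (schur_symm Q Y)
    (by positivity) (by positivity) (H.schur_entry_error st) (H.schur_entry_le st)
    (H.succeeds st)).trans ?_
  have h3 := mul_le_mul_of_nonneg_right H.unit_mul hα2
  have h4 := mul_le_mul_of_nonneg_right H.roundoff_le_unit
    (mul_nonneg (Nat.cast_nonneg (α := ℝ) N) hα2)
  nlinarith

lemma fac_lower (v : Fin s → ℝ) : σ / 2 * vnorm v ≤ vnorm (st.fac *ᵥ v) := by
  refine le_of_sq_le_sq ?_ (vnorm_nonneg _)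
  rw [vnorm_mulVec_sq_eq, mul_pow]
  have h1 := H.schur_lower v
  have h2 := (abs_le.1 (abs_quadratic_le
    (st.facᵀ * st.fac - (Yᵀ * Y - (Qᵀ * Y)ᵀ * (Qᵀ * Y))) v)).1
  rw [Matrix.sub_mulVec, dotProduct_sub] at h2
  have h3 := mul_le_mul_of_nonneg_right (H.fac_gram_error st) (sq_nonneg (vnorm v))
  have h4 := mul_le_mul_of_nonneg_right H.small (sq_nonneg (vnorm v))
  have h5 := mul_nonneg (mul_nonneg H.zeta_nonneg (sq_nonneg α)) (sq_nonneg (vnorm v))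
  have h6 := mul_nonneg (mul_nonneg H.omega_nonneg (sq_nonneg β)) (sq_nonneg (vnorm v))
  have h7 := mul_nonneg (sq_nonneg σ) (sq_nonneg (vnorm v))
  linarith

lemma norm_fac : ‖st.fac‖ ≤ 3 * α := by
  refine le_of_sq_le_sq ?_ (mul_nonneg zero_le_three H.alpha_pos.le)
  rw [← norm_transpose_mul_self]
  refine (norm_le_of_sub_le (H.fac_gram_error st) H.norm_schur_exact_le).trans ?_
  have := mul_le_mul_of_nonneg_right H.zeta_le (sq_nonneg α)
  linarith [sq_nonneg α]

lemma proj_error : ‖st.proj - (Y - Q * st.coef)‖ ≤ 7 * (h * α) := by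
  refine (FlSubMul.error H.eps_nonneg (by simpa using H.rows) H.prev (by simpa using H.cols)
    st.proj_spec).trans ?_
  have h1 := mul_le_mul H.norm_Q (H.norm_coef_fl st) (norm_nonneg _) zero_le_two
  have h2 := mul_le_mul H.unit (add_le_add H.norm_Y h1)
    (add_nonneg (norm_nonneg _) (mul_nonneg (norm_nonneg _) (norm_nonneg _))) H.unit_nonneg
  linarith

lemma proj_exact_error : ‖st.proj - (Y - Q * (Qᵀ * Y))‖ ≤ 11 * (h * α) := by
  have h1 := norm_mul_le_of_le H.norm_Q (H.coef_error st)
  have h2 := norm_add_le_of_eq (u := st.proj - (Y - Q * (Qᵀ * Y)))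
    (v := st.proj - (Y - Q * st.coef)) (w := -(Q * (st.coef - Qᵀ * Y)))
    (by rw [Matrix.mul_sub]; abel) (H.proj_error st) ((norm_neg _).trans_le h1)
  linarith

lemma norm_proj_exact : ‖Y - Q * (Qᵀ * Y)‖ ≤ 5 * α := by
  have h1 := norm_mul_le_of_le H.norm_Q H.norm_coef_le
  have h2 := norm_sub_le_of_le H.norm_Y h1
  linarith

lemma norm_proj : ‖st.proj‖ ≤ 6 * α := by
  refine (norm_le_of_sub_le (H.proj_exact_error st) H.norm_proj_exact).trans ?_
  have := mul_le_mul_of_nonneg_right H.unit_small H.alpha_pos.le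
  linarith [H.alpha_pos]

/-- The factor comes from a difference of Gram matrices and not from the projected block; this
compares the two. The error scales with `α²` and is later divided by `σ²`, hence the square of the
condition number in the hypothesis. -/
lemma proj_gram_error : ‖st.projᵀ * st.proj - st.facᵀ * st.fac‖ ≤ ω * β ^ 2 + 161 * (ζ * α ^ 2) := by
  have h1 := norm_gram_sub_gram_le (H.norm_proj st) H.norm_proj_exact (H.proj_exact_error st)
  have h2 := H.norm_defect_le
  have h3 := H.fac_gram_error st
  have heq := gram_proj_eq Q Y
  have h4 := norm_add_le_of_eq
    (u := (Y - Q * (Qᵀ * Y))ᵀ * (Y - Q * (Qᵀ * Y)) - st.facᵀ * st.fac)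
    (v := -(st.facᵀ * st.fac - (Yᵀ * Y - (Qᵀ * Y)ᵀ * (Qᵀ * Y))))
    (w := -((Qᵀ * Y)ᵀ * ((1 - Qᵀ * Q) * (Qᵀ * Y)))) (by rw [heq]; abel)
    ((norm_neg _).trans_le h3) ((norm_neg _).trans_le h2)
  have h5 := norm_add_le_of_eq (u := st.projᵀ * st.proj - st.facᵀ * st.fac)
    (v := st.projᵀ * st.proj - (Y - Q * (Qᵀ * Y))ᵀ * (Y - Q * (Qᵀ * Y)))
    (w := (Y - Q * (Qᵀ * Y))ᵀ * (Y - Q * (Qᵀ * Y)) - st.facᵀ * st.fac) (by abel) h1 h4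
  have h6 := mul_le_mul_of_nonneg_right H.unit_le (sq_nonneg α)
  linarith

lemma exists_fac_inverse :
    ∃ B, st.fac * B = 1 ∧ B * st.fac = 1 ∧ ‖B‖ ≤ 2 / σ := by
  obtain ⟨B, h1, h2, h3⟩ := exists_inverse_of_lower_bound st.fac (half_pos H.sep_pos)
    (H.fac_lower st)
  exact ⟨B, h1, h2, h3.trans_eq (by rw [one_div_div])⟩

lemma solve_error : ‖st.out * st.fac - st.proj‖ ≤ h * (6 * α + ‖st.out‖ * (3 * α)) := by
  refine (FlTriSolve.error H.eps_nonneg H.rows H.cols st.fac_spec.lower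
    (fun j => st.fac_spec.diag_ne_zero H.eps_nonneg H.roundoff_le_third (H.succeeds st j))
    st.out_spec).trans ?_
  have h1 := mul_le_mul_of_nonneg_left (H.norm_fac st) (norm_nonneg st.out)
  exact mul_le_mul H.unit (add_le_add (H.norm_proj st) h1)
    (add_nonneg (norm_nonneg _) (mul_nonneg (norm_nonneg _) (norm_nonneg _))) H.unit_nonneg

/-- With `B = fac⁻¹`, the Gram matrix of `proj * B` differs from the identity by `Bᵀ (projᵀ proj -
facᵀ fac) B`, of norm at most 1. The trivial bound on `‖proj‖ ‖B‖` would instead be of order `α /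
σ`. -/
lemma norm_out : ‖st.out‖ ≤ 2 := by
  obtain ⟨B, hB1, hB2, hB⟩ := H.exists_fac_inverse st
  have hσ := H.sep_pos
  have hVB : ‖st.proj * B‖ ≤ 3 / 2 := by
    refine le_of_sq_le_sq ?_ (by norm_num)
    rw [← norm_transpose_mul_self]
    have h1 : (st.proj * B)ᵀ * (st.proj * B) =
        Bᵀ * ((st.projᵀ * st.proj - st.facᵀ * st.fac) * B) + 1 := by
      have h2 : Bᵀ * (st.facᵀ * (st.fac * B)) = 1 := by
        rw [hB1, Matrix.mul_one, ← Matrix.transpose_mul, hB1, Matrix.transpose_one]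
      simp only [Matrix.sub_mul, Matrix.mul_sub, Matrix.transpose_mul, Matrix.mul_assoc, h2]
      abel
    refine (norm_add_le_of_eq h1 (norm_mul_le_of_le (norm_transpose_le hB)
      (norm_mul_le_of_le (H.proj_gram_error st) hB)) norm_one_le).trans ?_
    have h3 : 2 / σ * ((ω * β ^ 2 + 161 * (ζ * α ^ 2)) * (2 / σ)) =
        4 * (ω * β ^ 2 + 161 * (ζ * α ^ 2)) / σ ^ 2 := by field_simp; ring
    have h4 : 4 * (ω * β ^ 2 + 161 * (ζ * α ^ 2)) / σ ^ 2 ≤ 1 := by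
      rw [div_le_one (by positivity)]
      have := mul_nonneg H.omega_nonneg (sq_nonneg β)
      have := mul_nonneg H.zeta_nonneg (sq_nonneg α)
      linarith [H.small]
    rw [h3]
    linarith
  have h1 : st.out = st.proj * B + (st.out * st.fac - st.proj) * B := by
    rw [Matrix.sub_mul, Matrix.mul_assoc, hB1, Matrix.mul_one]
    abel
  -- The substitution error involves `‖st.out‖` itself, but with a tiny coefficient, so it can be
  -- moved to the left-hand side.
  have h2 := norm_add_le_of_eq h1 hVB (norm_mul_le_of_le (H.solve_error st) hB)
  have h3 : h * (6 * α + ‖st.out‖ * (3 * α)) * (2 / σ) =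
      (12 + 6 * ‖st.out‖) * (h * α / σ) := by field_simp; ring
  have h4 : h * α / σ ≤ 1 / 10000 := by
    rw [div_le_iff₀ hσ]
    linarith [H.unit_mul_le]
  have h5 := mul_le_mul_of_nonneg_left h4
    (show 0 ≤ 12 + 6 * ‖st.out‖ by linarith [norm_nonneg st.out])
  rw [h3] at h2
  linarith

lemma solve_error_le : ‖st.out * st.fac - st.proj‖ ≤ 12 * (h * α) := by
  have h1 := mul_le_mul_of_nonneg_right (H.norm_out st)
    (mul_nonneg zero_le_three H.alpha_pos.le)
  have h2 := mul_le_mul_of_nonneg_left h1 H.unit_nonneg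
  linarith [H.solve_error st]

/-- Residual of the computed step. -/
lemma residual : ‖Q * st.coef + st.out * st.fac - Y‖ ≤ 19 * (h * α) := by
  have := norm_add_le_of_eq (u := Q * st.coef + st.out * st.fac - Y)
    (v := st.out * st.fac - st.proj) (w := st.proj - (Y - Q * st.coef)) (by abel)
    (H.solve_error_le st) (H.proj_error st)
  linarith

/-- Loss of orthogonality of the computed block against the previous basis. -/
lemma norm_cross : ‖Qᵀ * st.out‖ ≤ (ω * β + 46 * (h * α)) * (2 / σ) := by
  obtain ⟨B, hB1, -, hB⟩ := H.exists_fac_inverse st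
  -- Since `Qᵀ (Y - Q Qᵀ Y) = (1 - Qᵀ Q) Qᵀ Y`, the exact projection contributes only the loss of
  -- orthogonality of `Q`.
  have h1 : Qᵀ * st.out = ((1 - Qᵀ * Q) * (Qᵀ * Y) + (Qᵀ * (st.proj - (Y - Q * (Qᵀ * Y))) +
      Qᵀ * (st.out * st.fac - st.proj))) * B := by
    have h2 : (1 - Qᵀ * Q) * (Qᵀ * Y) + (Qᵀ * (st.proj - (Y - Q * (Qᵀ * Y))) +
      Qᵀ * (st.out * st.fac - st.proj)) = Qᵀ * (st.out * st.fac) := by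
      simp only [Matrix.sub_mul, Matrix.mul_sub, Matrix.mul_assoc, Matrix.one_mul]
      abel
    rw [h2, Matrix.mul_assoc, Matrix.mul_assoc, hB1, Matrix.mul_one]
  rw [h1]
  refine norm_mul_le_of_le ?_ hB
  refine (norm_add_le_of_le (norm_mul_le_of_le H.orth H.norm_coef) (norm_add_le_of_le
    (norm_mul_le_of_le H.norm_Qt (H.proj_exact_error st))
    (norm_mul_le_of_le H.norm_Qt (H.solve_error_le st)))).trans ?_
  linarith

/-- Loss of orthogonality within the computed block. -/
lemma norm_one_sub_gram :
    ‖1 - st.outᵀ * st.out‖ ≤ 4 * (ω * β ^ 2 + 320 * (ζ * α ^ 2)) / σ ^ 2 := by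
  obtain ⟨B, hB1, -, hB⟩ := H.exists_fac_inverse st
  have hσ := H.sep_pos
  have hα := H.alpha_pos
  have hh := H.unit_nonneg
  have h1 : 1 - st.outᵀ * st.out =
      Bᵀ * ((st.facᵀ * st.fac - (st.out * st.fac)ᵀ * (st.out * st.fac)) * B) := by
    have h2 : Bᵀ * (st.facᵀ * (st.fac * B)) = 1 := by
      rw [hB1, Matrix.mul_one, ← Matrix.transpose_mul, hB1, Matrix.transpose_one]
    have h3 : Bᵀ * ((st.out * st.fac)ᵀ * (st.out * st.fac * B)) = st.outᵀ * st.out := by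
      rw [Matrix.mul_assoc st.out, hB1, Matrix.mul_one, Matrix.transpose_mul, Matrix.mul_assoc,
        ← Matrix.mul_assoc Bᵀ, ← Matrix.transpose_mul, hB1, Matrix.transpose_one, Matrix.one_mul]
    rw [Matrix.sub_mul, Matrix.mul_sub, Matrix.mul_assoc, h2, Matrix.mul_assoc (st.out * st.fac)ᵀ,
      h3]
  have hZL : ‖st.out * st.fac‖ ≤ 13 / 2 * α := by
    refine (norm_le_of_sub_le (H.solve_error_le st) (H.norm_proj st)).trans ?_
    have := mul_le_mul_of_nonneg_right H.unit_small hα.le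
    linarith
  have h4 := norm_gram_sub_gram_le hZL (H.norm_proj st) (H.solve_error_le st)
  have h5 := norm_add_le_of_eq
    (u := st.facᵀ * st.fac - (st.out * st.fac)ᵀ * (st.out * st.fac))
    (v := -((st.out * st.fac)ᵀ * (st.out * st.fac) - st.projᵀ * st.proj))
    (w := -(st.projᵀ * st.proj - st.facᵀ * st.fac)) (by abel)
    ((norm_neg _).trans_le h4) ((norm_neg _).trans_le (H.proj_gram_error st))
  have h6 : 13 / 2 * α * (12 * (h * α)) + 12 * (h * α) * (6 * α) +
      (ω * β ^ 2 + 161 * (ζ * α ^ 2)) ≤ ω * β ^ 2 + 320 * (ζ * α ^ 2) := by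
    have := mul_le_mul_of_nonneg_right H.unit_le (sq_nonneg α)
    have := mul_nonneg H.zeta_nonneg (sq_nonneg α)
    linarith
  rw [h1]
  refine (norm_mul_le_of_le (norm_transpose_le hB)
    (norm_mul_le_of_le (h5.trans h6) hB)).trans_eq ?_
  field_simp
  ring

end

end StepHyp

end Step

/-! ### The two steps of one block: reorthogonalization. -/

section DoubleStep

/-- Expanding the square leaves at least `3/4 a² - 1/2 a b + 1/2 b²` with `a = ‖v‖`, `b = ‖w‖`,
which exceeds `a² / 4`. It supplies the separation hypothesis of the second step. -/
lemma half_vnorm_le_of_nearly_orthonormal {ι κ ν : Type*} [Fintype ι] [Fintype κ] [Fintype ν]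
    [DecidableEq κ] [DecidableEq ν] [DecidableEq ι] {Q : Matrix ι κ ℝ} {Z : Matrix ι ν ℝ}
    (hQ : ‖1 - Qᵀ * Q‖ ≤ 1 / 2) (hQZ : ‖Qᵀ * Z‖ ≤ 1 / 4) (hZ : ‖1 - Zᵀ * Z‖ ≤ 1 / 4)
    (v : ν → ℝ) (w : κ → ℝ) : 1 / 2 * vnorm v ≤ vnorm (Z *ᵥ v - Q *ᵥ w) := by
  refine le_of_sq_le_sq ?_ (vnorm_nonneg _)
  have h1 : vnorm (Z *ᵥ v - Q *ᵥ w) ^ 2 =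
      vnorm (Z *ᵥ v) ^ 2 - 2 * (w ⬝ᵥ (Qᵀ * Z) *ᵥ v) + vnorm (Q *ᵥ w) ^ 2 := by
    have h2 : w ⬝ᵥ (Qᵀ * Z) *ᵥ v = Q *ᵥ w ⬝ᵥ Z *ᵥ v := by
      rw [← Matrix.mulVec_mulVec, Matrix.dotProduct_mulVec w, Matrix.vecMul_transpose]
    rw [h2, vnorm_sq, vnorm_sq, vnorm_sq]
    simp only [sub_dotProduct, dotProduct_sub]
    rw [dotProduct_comm (Z *ᵥ v) (Q *ᵥ w)]
    ring
  have h2 := (abs_le.1 (abs_quadratic_le (1 - Zᵀ * Z) v)).2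
  have h3 := (abs_le.1 (abs_quadratic_le (1 - Qᵀ * Q) w)).2
  rw [Matrix.sub_mulVec, dotProduct_sub, Matrix.one_mulVec, ← vnorm_sq, ← vnorm_mulVec_sq_eq]
    at h2 h3
  have h4 := (abs_le.1 (abs_dotProduct_le w ((Qᵀ * Z) *ᵥ v))).2
  have h5 := mul_le_mul_of_nonneg_left ((vnorm_mulVec_le (Qᵀ * Z) v).trans
    (mul_le_mul_of_nonneg_right hQZ (vnorm_nonneg v))) (vnorm_nonneg w)
  have h6 := mul_le_mul_of_nonneg_right hZ (sq_nonneg (vnorm v))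
  have h7 := mul_le_mul_of_nonneg_right hQ (sq_nonneg (vnorm w))
  rw [h1]
  nlinarith [sq_nonneg (vnorm v - vnorm w), sq_nonneg (vnorm v), sq_nonneg (vnorm w)]

variable {ε : ℝ} {fl : FlArith ε} {m s N : ℕ} {κ : Type} [Fintype κ] [DecidableEq κ]
  {Q : Matrix (Fin m) κ ℝ} {Y : Matrix (Fin m) (Fin s) ℝ}

/-- Hypotheses of the analysis of the two computed steps for one block. -/
structure DoubleHyp (ε : ℝ) (N : ℕ) (Q : Matrix (Fin m) κ ℝ) (Y : Matrix (Fin m) (Fin s) ℝ)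
    (K α σ h ζ : ℝ) : Prop where
  eps_nonneg : 0 ≤ ε
  rows : m ≤ N
  cols : s ≤ N
  prev : Fintype.card κ ≤ N
  pos : 1 ≤ N
  unit : N * roundoff ε N ≤ h
  unit_mul : N * h ≤ ζ
  const_nonneg : 0 ≤ K
  orth : ‖1 - Qᵀ * Q‖ ≤ K * ζ
  norm_Y : ‖Y‖ ≤ α
  sep : ∀ v w, σ * vnorm v ≤ vnorm (Y *ᵥ v - Q *ᵥ w)
  sep_pos : 0 < σ
  sep_le : σ ≤ α
  small : 1000000 * ((1 + K) ^ 2 * (ζ * α ^ 2)) ≤ σ ^ 2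

namespace DoubleHyp

variable {K α σ h ζ : ℝ}

section

variable (H : DoubleHyp ε N Q Y K α σ h ζ)
include H

lemma alpha_pos : 0 < α := H.sep_pos.trans_le H.sep_le

lemma unit_nonneg : 0 ≤ h :=
  (mul_nonneg (Nat.cast_nonneg N) (roundoff_nonneg H.eps_nonneg N)).trans H.unit

lemma unit_le : h ≤ ζ := by
  have h1 : (1 : ℝ) ≤ N := by exact_mod_cast H.pos
  have := mul_le_mul_of_nonneg_right h1 H.unit_nonneg
  linarith [H.unit_mul]

lemma zeta_nonneg : 0 ≤ ζ := H.unit_nonneg.trans H.unit_le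

lemma ratio_small : 1000000 * ((1 + K) ^ 2 * (ζ * α)) ≤ σ := by
  have h1 := H.small
  have h3 := mul_le_mul_of_nonneg_left H.sep_le H.sep_pos.le
  have h5 : (1000000 * ((1 + K) ^ 2 * (ζ * α))) * α ≤ σ * α := by nlinarith
  exact le_of_mul_le_mul_right h5 H.alpha_pos

lemma const_small : 1000000 * ((1 + K) ^ 2 * ζ) ≤ 1 := by
  have h1 := H.ratio_small.trans H.sep_le
  have h5 : (1000000 * ((1 + K) ^ 2 * ζ)) * α ≤ 1 * α := by linarith
  exact le_of_mul_le_mul_right h5 H.alpha_pos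

lemma zeta_small : 1000000 * ζ ≤ 1 := by
  have h1 := H.const_small
  have h2 : (1 : ℝ) ≤ (1 + K) ^ 2 := one_le_pow₀ (by linarith [H.const_nonneg])
  have := mul_le_mul_of_nonneg_right h2 H.zeta_nonneg
  linarith

lemma const_mul_small : 1000000 * (K * ζ) ≤ 1 := by
  have h1 := H.const_small
  have h2 : K ≤ (1 + K) ^ 2 := by nlinarith [H.const_nonneg, sq_nonneg K]
  have := mul_le_mul_of_nonneg_right h2 H.zeta_nonneg
  linarith

/-- Only the crude bound `‖Qᵀ Y‖ ≤ 2 α` is available here, so the old loss contributes `4 K ζ α²`,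
which `small` still dominates. -/
lemma first_hyp : StepHyp ε N Q Y (K * ζ) α (2 * α) σ h ζ := by
  have hω := H.const_mul_small
  have hα := H.alpha_pos
  refine ⟨H.eps_nonneg, H.rows, H.cols, H.prev, H.pos, H.unit, H.unit_mul, H.orth, by linarith,
    H.norm_Y, ?_, H.sep, H.sep_pos, H.sep_le, ?_⟩
  · exact norm_mul_le_of_le
      (norm_transpose_le (norm_le_two_of_gram Q H.orth (by linarith))) H.norm_Y
  · have h1 : 1 + 4 * K ≤ 4 * (1 + K) ^ 2 := by nlinarith [H.const_nonneg, sq_nonneg K]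
    have h2 : 0 ≤ ζ * α ^ 2 := mul_nonneg H.zeta_nonneg (sq_nonneg α)
    have h3 := mul_le_mul_of_nonneg_right h1 h2
    have h4 := H.small
    nlinarith [mul_nonneg (sq_nonneg (1 + K)) h2]

variable (st : PIPStep fl Q Y)

/-- Bound of the loss of orthogonality after the first step. -/
lemma cross_bound :
    (K * ζ * (2 * α) + 46 * (h * α)) * (2 / σ) ≤ 1 / 10000 ∧
      K * ζ * ((K * ζ * (2 * α) + 46 * (h * α)) * (2 / σ)) ≤ ζ := by
  have hσ := H.sep_pos
  have hα := H.alpha_pos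
  have hK := H.const_nonneg
  have hζ := H.zeta_nonneg
  have h0 : h * α ≤ ζ * α := mul_le_mul_of_nonneg_right H.unit_le hα.le
  have hx : 0 ≤ ζ * α := mul_nonneg hζ hα.le
  have h1 : (K * ζ * (2 * α) + 46 * (h * α)) * (2 / σ) ≤ 92 * (1 + K) * (ζ * α) / σ := by
    rw [mul_div_assoc', div_le_div_iff_of_pos_right hσ]
    nlinarith [mul_nonneg hK hx]
  have h2 := H.ratio_small
  constructor
  · refine h1.trans ?_
    rw [div_le_iff₀ hσ]
    nlinarith [mul_nonneg hK hx, mul_nonneg (sq_nonneg K) hx]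
  -- The old loss meets a cross term of order `(1 + K) ζ α / σ`; this product is the reason for the
  -- square of `1 + K` in `small`.
  · refine (mul_le_mul_of_nonneg_left h1 (mul_nonneg hK hζ)).trans ?_
    have h3 : K * ζ * (92 * (1 + K) * (ζ * α) / σ) = ζ * (92 * (K * (1 + K) * (ζ * α)) / σ) := by
      field_simp
    rw [h3]
    refine mul_le_of_le_one_right hζ ?_
    rw [div_le_one hσ]
    nlinarith [mul_nonneg hK hx, mul_nonneg (sq_nonneg K) hx]

/-- After the first step the block has norm at most 2 and separation at least 1/2, so every bound
for the second step is independent of `α / σ`. -/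
lemma second_hyp : StepHyp ε N Q st.out (K * ζ) 2
    ((K * ζ * (2 * α) + 46 * (h * α)) * (2 / σ)) (1 / 2) h ζ := by
  have hω := H.const_mul_small
  have H1 := H.first_hyp
  obtain ⟨hb1, hb2⟩ := H.cross_bound
  have hcross := H1.norm_cross st
  set β := (K * ζ * (2 * α) + 46 * (h * α)) * (2 / σ)
  have hβ : 0 ≤ β := (norm_nonneg _).trans hcross
  refine ⟨H.eps_nonneg, H.rows, H.cols, H.prev, H.pos, H.unit, H.unit_mul, H.orth, by linarith,
    H1.norm_out st, hcross, ?_, by norm_num, by norm_num, ?_⟩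
  · refine half_vnorm_le_of_nearly_orthonormal (H.orth.trans (by linarith))
      (hcross.trans (by linarith)) ((H1.norm_one_sub_gram st).trans ?_)
    rw [div_le_iff₀ (pow_pos H.sep_pos 2)]
    have h1 := H1.small
    have h2 := mul_nonneg H1.omega_nonneg (sq_nonneg (2 * α))
    linarith [sq_nonneg σ]
  · have h1 := H.zeta_small
    have h2 : K * ζ * β ^ 2 ≤ ζ * 1 := by
      rw [sq, ← mul_assoc]
      exact mul_le_mul hb2 (by linarith) hβ H.zeta_nonneg
    linarith

variable (st2 : PIPStep fl Q st.out)

/-- The constant does not involve `K`: the new loss does not inherit the old one. -/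
lemma cross_le : ‖Qᵀ * st2.out‖ ≤ 400 * ζ := by
  have h1 := (H.second_hyp st).norm_cross st2
  have h2 := H.cross_bound.2
  have h3 := H.unit_le
  have := H.zeta_nonneg
  norm_num at h1
  linarith

lemma one_sub_gram_le : ‖1 - st2.outᵀ * st2.out‖ ≤ 21000 * ζ := by
  have h1 := (H.second_hyp st).norm_one_sub_gram st2
  obtain ⟨hb1, hb2⟩ := H.cross_bound
  have hcross := H.first_hyp.norm_cross st
  set β := (K * ζ * (2 * α) + 46 * (h * α)) * (2 / σ)
  have hβ : 0 ≤ β := (norm_nonneg _).trans hcross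
  have h2 : K * ζ * β ^ 2 ≤ ζ * 1 := by
    rw [sq, ← mul_assoc]
    exact mul_le_mul hb2 (by linarith) hβ H.zeta_nonneg
  have := H.zeta_nonneg
  norm_num at h1
  linarith

/-- The residual of the second step is multiplied by the first factor, of norm at most `3 α`, and
the errors in forming `R` by blocks of norm at most 2: `211 = 19 + 38 * 3 + 2 * 21 + 2 * 18`. -/
lemma residual_le {Rab : Matrix κ (Fin s) ℝ} {Rd : Matrix (Fin s) (Fin s) ℝ}
    (hab : FlAddMul fl st.coef st2.coef st.fac Rab) (hd : FlMul fl st2.fac st.fac Rd) :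
    ‖Q * Rab + st2.out * Rd - Y‖ ≤ 211 * (h * α) := by
  have H1 := H.first_hyp
  have H2 := H.second_hyp st
  have hα := H.alpha_pos
  have hs : Fintype.card (Fin s) ≤ N := by simpa using H.cols
  have hfac := H1.norm_fac st
  have hE1 : ‖Rab - (st.coef + st2.coef * st.fac)‖ ≤ 21 * (h * α) := by
    refine (FlAddMul.error H.eps_nonneg H.prev hs hs hab).trans ?_
    have h1 := mul_le_mul (H2.norm_coef_fl st2) hfac (norm_nonneg _) (by norm_num)
    have h2 := mul_le_mul H.unit (add_le_add (H1.norm_coef_fl st) h1)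
      (add_nonneg (norm_nonneg _) (mul_nonneg (norm_nonneg _) (norm_nonneg _))) H.unit_nonneg
    linarith
  have hE2 : ‖Rd - st2.fac * st.fac‖ ≤ 18 * (h * α) := by
    refine (FlMul.error H.eps_nonneg hs hs hs hd).trans ?_
    have h1 := mul_le_mul (H2.norm_fac st2) hfac (norm_nonneg _) (by norm_num)
    have h2 := mul_le_mul H.unit h1
      (mul_nonneg (norm_nonneg _) (norm_nonneg _)) H.unit_nonneg
    linarith
  have hsplit : Q * Rab + st2.out * Rd - Y =
      (Q * st.coef + st.out * st.fac - Y) +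
      ((Q * st2.coef + st2.out * st2.fac - st.out) * st.fac +
      (Q * (Rab - (st.coef + st2.coef * st.fac)) + st2.out * (Rd - st2.fac * st.fac))) := by
    simp only [Matrix.mul_sub, Matrix.mul_add, Matrix.sub_mul, Matrix.add_mul, Matrix.mul_assoc]
    abel
  have h4 := norm_add_le_of_eq hsplit (H1.residual st) (norm_add_le_of_le
    (norm_mul_le_of_le (H2.residual st2) hfac) (norm_add_le_of_le
    (norm_mul_le_of_le H1.norm_Q hE1) (norm_mul_le_of_le (H2.norm_out st2) hE2)))
  linarith

end

end DoubleHyp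

end DoubleStep

/-! ### Selecting columns: norm, smallest singular value, condition number. -/

section Submatrix

variable {ι κ ν : Type*} [Fintype ι] [Fintype κ] [Fintype ν]
  [DecidableEq ι] [DecidableEq κ] [DecidableEq ν]

lemma submatrix_mulVec_eq_extend (A : Matrix ι ν ℝ) {f : κ → ν} (hf : f.Injective) (v : κ → ℝ) :
    A.submatrix id f *ᵥ v = A *ᵥ Function.extend f v 0 := by
  ext i
  simp only [Matrix.mulVec, dotProduct, Matrix.submatrix_apply, id]
  refine Fintype.sum_of_injective f hf _ _ (fun j hj => ?_) fun j => ?_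
  · rw [Function.extend_apply' _ _ _ (by simpa using hj)]
    simp
  · rw [hf.extend_apply]

lemma vnorm_extend {f : κ → ν} (hf : f.Injective) (v : κ → ℝ) :
    vnorm (Function.extend f v 0) = vnorm v := by
  refine (pow_left_inj₀ (vnorm_nonneg _) (vnorm_nonneg _) two_ne_zero).1 ?_
  rw [vnorm_sq_eq_sum, vnorm_sq_eq_sum]
  refine (Fintype.sum_of_injective f hf _ _ (fun j hj => ?_) fun j => ?_).symm
  · rw [Function.extend_apply' _ _ _ (by simpa using hj)]
    simp
  · rw [hf.extend_apply]

lemma norm_submatrix_le (A : Matrix ι ν ℝ) {f : κ → ν} (hf : f.Injective) :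
    ‖A.submatrix id f‖ ≤ ‖A‖ := by
  refine norm_le_of_vnorm _ (norm_nonneg _) fun v => ?_
  rw [submatrix_mulVec_eq_extend A hf, ← vnorm_extend hf v]
  exact vnorm_mulVec_le _ _

lemma sigmaMin_mul_vnorm_le_submatrix (A : Matrix ι ν ℝ) {f : κ → ν} (hf : f.Injective)
    (v : κ → ℝ) : sigmaMin A * vnorm v ≤ vnorm (A.submatrix id f *ᵥ v) := by
  rw [submatrix_mulVec_eq_extend A hf, ← vnorm_extend hf v]
  exact sigmaMin_mul_vnorm_le _ _

/-- Makes the assumption on the intraorthogonalization applicable to the first block. -/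
lemma cond_submatrix_le [Nonempty κ] [Nonempty ν] (A : Matrix ι ν ℝ) {f : κ → ν}
    (hf : f.Injective) (hA : 0 < sigmaMin A) : cond (A.submatrix id f) ≤ cond A := by
  rw [cond_eq, cond_eq]
  exact div_le_div₀ (norm_nonneg _) (norm_submatrix_le A hf) hA
    (le_sigmaMin _ (sigmaMin_mul_vnorm_le_submatrix A hf))

end Submatrix

/-! ### Appending one block: splitting of vectors, Gram matrices and residuals. -/

section Blocks

variable {m p s : ℕ}

lemma injective_before (P : Fin p → Prop) :
    Function.Injective fun j : {j : Fin p // P j} × Fin s => (j.1.1, j.2) := by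
  rintro ⟨⟨a, ha⟩, b⟩ ⟨⟨c, hc⟩, d⟩ h
  simpa using h

lemma injective_block (k : Fin p) : Function.Injective fun b : Fin s => (k, b) :=
  fun _ _ h => (Prod.ext_iff.1 h).2

lemma sum_upTo {k : Fin p} (f : UpTo s k → ℝ) :
    ∑ j, f j = (∑ j : Before s k, f (⟨j.1.1, j.1.2.le⟩, j.2)) + ∑ b, f (⟨k, le_rfl⟩, b) := by
  rw [Fintype.sum_prod_type, Fintype.sum_prod_type, add_comm]
  -- The blocks up to `k` are `Option` of those before `k`, with `none` standing for `k`.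
  have h := Fintype.sum_bijective
    (fun o : Option {j : Fin p // j < k} =>
      (o.elim ⟨k, le_rfl⟩ fun j => ⟨j.1, j.2.le⟩ : {j : Fin p // j ≤ k}))
    ⟨?_, ?_⟩ (fun o => ∑ b, f (o.elim ⟨k, le_rfl⟩ fun j => ⟨j.1, j.2.le⟩, b))
    (fun j => ∑ b, f (j, b)) (fun _ => rfl)
  · rw [← h, Fintype.sum_option]
    rfl
  · rintro (_ | ⟨a, ha⟩) (_ | ⟨b, hb⟩) h
    · rfl
    · exact absurd (congrArg Subtype.val h) hb.ne'
    · exact absurd (congrArg Subtype.val h) ha.ne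
    · have h' : a = b := congrArg Subtype.val h
      subst h'
      rfl
  · rintro ⟨j, hj⟩
    rcases hj.eq_or_lt with rfl | h
    · exact ⟨none, rfl⟩
    · exact ⟨some ⟨j, h⟩, rfl⟩

/-- The entries of a vector that belong to the blocks strictly before `k`. -/
def vecBefore {k : Fin p} (v : UpTo s k → ℝ) : Before s k → ℝ :=
  fun j => v (⟨j.1.1, j.1.2.le⟩, j.2)

/-- The entries of a vector that belong to block `k`. -/
def vecLast {k : Fin p} (v : UpTo s k → ℝ) : Fin s → ℝ := fun b => v (⟨k, le_rfl⟩, b)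

lemma dotProduct_upTo {k : Fin p} (u v : UpTo s k → ℝ) :
    u ⬝ᵥ v = vecBefore u ⬝ᵥ vecBefore v + vecLast u ⬝ᵥ vecLast v :=
  sum_upTo _

lemma vnorm_sq_upTo {k : Fin p} (v : UpTo s k → ℝ) :
    vnorm v ^ 2 = vnorm (vecBefore v) ^ 2 + vnorm (vecLast v) ^ 2 := by
  simp only [vnorm_sq, dotProduct_upTo]

lemma vnorm_vecBefore_le {k : Fin p} (v : UpTo s k → ℝ) : vnorm (vecBefore v) ≤ vnorm v :=
  le_of_sq_le_sq (by rw [vnorm_sq_upTo v]; linarith [sq_nonneg (vnorm (vecLast v))])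
    (vnorm_nonneg _)

lemma vnorm_vecLast_le {k : Fin p} (v : UpTo s k → ℝ) : vnorm (vecLast v) ≤ vnorm v :=
  le_of_sq_le_sq (by rw [vnorm_sq_upTo v]; linarith [sq_nonneg (vnorm (vecBefore v))])
    (vnorm_nonneg _)

lemma colsUpTo_mulVec (A : Matrix (Fin m) (Fin p × Fin s) ℝ) {k : Fin p} (v : UpTo s k → ℝ) :
    colsUpTo A k *ᵥ v = colsBefore A k *ᵥ vecBefore v + blockCol A k *ᵥ vecLast v := by
  ext i
  exact sum_upTo _

/-- The leading principal block submatrix of the blocks strictly before `k`. -/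
def leadingBefore (R : Matrix (Fin p × Fin s) (Fin p × Fin s) ℝ) (k : Fin p) :
    Matrix (Before s k) (Before s k) ℝ :=
  R.submatrix (fun i => (i.1.1, i.2)) fun j => (j.1.1, j.2)

lemma vecBefore_leading_mulVec (R : Matrix (Fin p × Fin s) (Fin p × Fin s) ℝ) {k : Fin p}
    (v : UpTo s k → ℝ) : vecBefore (leading R k *ᵥ v) =
      leadingBefore R k *ᵥ vecBefore v + aboveDiag R k *ᵥ vecLast v := by
  ext i
  exact sum_upTo _

lemma vecLast_leading_mulVec {R : Matrix (Fin p × Fin s) (Fin p × Fin s) ℝ}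
    (hR : ∀ i j, j < i → block R i j = 0) {k : Fin p} (v : UpTo s k → ℝ) :
    vecLast (leading R k *ᵥ v) = block R k k *ᵥ vecLast v := by
  ext a
  refine (sum_upTo _).trans ?_
  rw [Finset.sum_eq_zero, zero_add]
  · rfl
  · intro j _
    have := congrFun (congrFun (hR k j.1.1 j.1.2) a) j.2
    change R (k, a) (j.1.1, j.2) = 0 at this
    change R (k, a) (j.1.1, j.2) * _ = 0
    rw [this, zero_mul]

lemma norm_one_sub_gram_upTo (Q : Matrix (Fin m) (Fin p × Fin s) ℝ) (k : Fin p) {ω e f : ℝ}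
    (hω : ‖1 - (colsBefore Q k)ᵀ * colsBefore Q k‖ ≤ ω)
    (he : ‖(colsBefore Q k)ᵀ * blockCol Q k‖ ≤ e)
    (hf : ‖1 - (blockCol Q k)ᵀ * blockCol Q k‖ ≤ f) :
    ‖1 - (colsUpTo Q k)ᵀ * colsUpTo Q k‖ ≤ ω + f + 2 * e := by
  have hω0 := (norm_nonneg _).trans hω
  have he0 := (norm_nonneg _).trans he
  have hf0 := (norm_nonneg _).trans hf
  have hform : ∀ {ι κ ν : Type} [Fintype ι] [Fintype κ] [Fintype ν] [DecidableEq κ] [DecidableEq ν]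
      (A : Matrix ι κ ℝ) (B : Matrix ι ν ℝ) (u : κ → ℝ) (v : ν → ℝ),
      u ⬝ᵥ (Aᵀ * B) *ᵥ v = A *ᵥ u ⬝ᵥ B *ᵥ v := by
    intros
    rw [← Matrix.mulVec_mulVec, Matrix.dotProduct_mulVec, Matrix.vecMul_transpose]
  refine norm_le_of_bilin _ (by positivity) fun u v => ?_
  have h1 : u ⬝ᵥ (1 - (colsUpTo Q k)ᵀ * colsUpTo Q k) *ᵥ v =
      vecBefore u ⬝ᵥ (1 - (colsBefore Q k)ᵀ * colsBefore Q k) *ᵥ vecBefore v +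
      vecLast u ⬝ᵥ (1 - (blockCol Q k)ᵀ * blockCol Q k) *ᵥ vecLast v -
      (vecBefore u ⬝ᵥ ((colsBefore Q k)ᵀ * blockCol Q k) *ᵥ vecLast v +
      vecBefore v ⬝ᵥ ((colsBefore Q k)ᵀ * blockCol Q k) *ᵥ vecLast u) := by
    simp only [Matrix.sub_mulVec, Matrix.one_mulVec, dotProduct_sub, hform, colsUpTo_mulVec,
      add_dotProduct, dotProduct_add]
    rw [dotProduct_upTo u v, dotProduct_comm (blockCol Q k *ᵥ vecLast u) (colsBefore Q k *ᵥ _)]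
    ring
  have hb : ∀ {κ ν : Type} [Fintype κ] [Fintype ν] [DecidableEq κ] [DecidableEq ν]
      (A : Matrix κ ν ℝ) (c : ℝ) (x : κ → ℝ) (y : ν → ℝ) (a b : ℝ), ‖A‖ ≤ c → vnorm x ≤ a →
      vnorm y ≤ b → |x ⬝ᵥ A *ᵥ y| ≤ c * (a * b) := by
    intro κ ν _ _ _ _ A c x y a b hc hx hy
    have h2 := (vnorm_mulVec_le A y).trans
      (mul_le_mul hc hy (vnorm_nonneg _) ((norm_nonneg _).trans hc))
    have h3 := mul_le_mul hx h2 (vnorm_nonneg _) ((vnorm_nonneg _).trans hx)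
    linarith [abs_dotProduct_le x (A *ᵥ y)]
  have hu1 := vnorm_vecBefore_le u
  have hu2 := vnorm_vecLast_le u
  have hv1 := vnorm_vecBefore_le v
  have hv2 := vnorm_vecLast_le v
  have k1 := abs_le.1 (hb _ _ _ _ _ _ hω hu1 hv1)
  have k2 := abs_le.1 (hb _ _ _ _ _ _ hf hu2 hv2)
  have k3 := abs_le.1 (hb _ _ _ _ _ _ he hu1 hv2)
  have k4 := abs_le.1 (hb _ _ _ _ _ _ he hv1 hu2)
  rw [h1, abs_le]
  constructor <;> linarith [k1.1, k1.2, k2.1, k2.2, k3.1, k3.2, k4.1, k4.2]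

lemma norm_residual_upTo {Q X : Matrix (Fin m) (Fin p × Fin s) ℝ}
    {R : Matrix (Fin p × Fin s) (Fin p × Fin s) ℝ} (hR : ∀ i j, j < i → block R i j = 0)
    (k : Fin p) {δ r : ℝ}
    (hδ : ‖colsBefore Q k * leadingBefore R k - colsBefore X k‖ ≤ δ)
    (hr : ‖colsBefore Q k * aboveDiag R k + blockCol Q k * block R k k - blockCol X k‖ ≤ r) :
    ‖colsUpTo Q k * leading R k - colsUpTo X k‖ ≤ δ + r := by
  have hδ0 := (norm_nonneg _).trans hδ
  have hr0 := (norm_nonneg _).trans hr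
  refine norm_le_of_vnorm _ (by positivity) fun v => ?_
  have h1 : (colsUpTo Q k * leading R k - colsUpTo X k) *ᵥ v =
      (colsBefore Q k * leadingBefore R k - colsBefore X k) *ᵥ vecBefore v +
      (colsBefore Q k * aboveDiag R k + blockCol Q k * block R k k - blockCol X k) *ᵥ
        vecLast v := by
    simp only [Matrix.sub_mulVec, Matrix.add_mulVec, ← Matrix.mulVec_mulVec, colsUpTo_mulVec,
      vecBefore_leading_mulVec, vecLast_leading_mulVec hR, Matrix.mulVec_add]
    abel
  rw [h1]
  refine (vnorm_add_le _ _).trans ?_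
  have h2 := (vnorm_mulVec_le _ (vecBefore v)).trans
    (mul_le_mul hδ (vnorm_vecBefore_le v) (vnorm_nonneg _) hδ0)
  have h3 := (vnorm_mulVec_le _ (vecLast v)).trans
    (mul_le_mul hr (vnorm_vecLast_le v) (vnorm_nonneg _) hr0)
  linarith

/-- Block `k` of `X` keeps its distance from the range of the previous basis. -/
lemma separation {Q X : Matrix (Fin m) (Fin p × Fin s) ℝ}
    {R : Matrix (Fin p × Fin s) (Fin p × Fin s) ℝ} (k : Fin p) (hX : 0 < sigmaMin X)
    (hQ : ‖colsBefore Q k‖ ≤ 2)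
    (hδ : ‖colsBefore Q k * leadingBefore R k - colsBefore X k‖ ≤ sigmaMin X / 2)
    (v : Fin s → ℝ) (w : Before s k → ℝ) :
    sigmaMin X / 2 * vnorm v ≤ vnorm (blockCol X k *ᵥ v - colsBefore Q k *ᵥ w) := by
  set σ := sigmaMin X
  set E := colsBefore Q k * leadingBefore R k - colsBefore X k with hE
  have hEu : ∀ u, vnorm (E *ᵥ u) ≤ σ / 2 * vnorm u := fun u =>
    (vnorm_mulVec_le E u).trans (mul_le_mul_of_nonneg_right hδ (vnorm_nonneg u))
  have hQR : ∀ u, colsBefore Q k *ᵥ (leadingBefore R k *ᵥ u) =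
      colsBefore X k *ᵥ u + E *ᵥ u := fun u => by
    rw [hE, Matrix.sub_mulVec, Matrix.mulVec_mulVec]
    abel
  -- `Q R = X + E` is bounded below by `σ / 2` and `‖Q‖ ≤ 2`, so `R` is invertible and every `Q w`
  -- has the form `(X + E) u`.
  have hRlow : ∀ u, σ / 4 * vnorm u ≤ vnorm (leadingBefore R k *ᵥ u) := by
    intro u
    have h1 := (vnorm_mulVec_le (colsBefore Q k) (leadingBefore R k *ᵥ u)).trans
      (mul_le_mul_of_nonneg_right hQ (vnorm_nonneg _))
    rw [hQR] at h1
    have h2 := vnorm_sub_le (colsBefore X k *ᵥ u) (E *ᵥ u)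
    have h2' : vnorm (colsBefore X k *ᵥ u) - vnorm (E *ᵥ u) ≤
        vnorm (colsBefore X k *ᵥ u + E *ᵥ u) := h2
    have h3 : σ * vnorm u ≤ vnorm (colsBefore X k *ᵥ u) :=
      sigmaMin_mul_vnorm_le_submatrix X (injective_before _) u
    linarith [hEu u]
  obtain ⟨B, hB1, -, -⟩ := exists_inverse_of_lower_bound _ (by positivity) hRlow
  set u := B *ᵥ w with hu
  have hw : w = leadingBefore R k *ᵥ u := by
    rw [hu, Matrix.mulVec_mulVec, hB1, Matrix.one_mulVec]
  -- With coefficients `(-u, v)` the difference becomes a combination of the columns of `X` up to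
  -- `k`, where `sigmaMin X` applies; the term from `E` costs at most half of it.
  set z : UpTo s k → ℝ := fun j => if h : j.1.1 < k then -u (⟨j.1.1, h⟩, j.2) else v j.2 with hz
  have hzB : vecBefore z = -u := by
    ext ⟨⟨j, hj⟩, b⟩
    simp [vecBefore, hz, hj]
  have hzL : vecLast z = v := by
    ext b
    simp [vecLast, hz]
  have h1 : blockCol X k *ᵥ v - colsBefore Q k *ᵥ w = colsUpTo X k *ᵥ z + E *ᵥ vecBefore z := by
    rw [hw, hQR, colsUpTo_mulVec, hzB, hzL, Matrix.mulVec_neg, Matrix.mulVec_neg]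
    abel
  have h2 := vnorm_sub_le (colsUpTo X k *ᵥ z) (E *ᵥ vecBefore z)
  have h3 : σ * vnorm z ≤ vnorm (colsUpTo X k *ᵥ z) :=
    sigmaMin_mul_vnorm_le_submatrix X (injective_before _) z
  have h4 := hEu (vecBefore z)
  have h5 := mul_le_mul_of_nonneg_left (vnorm_vecBefore_le z) (half_pos hX).le
  have h6 := mul_le_mul_of_nonneg_left (vnorm_vecLast_le z) (half_pos hX).le
  rw [h1]
  rw [hzL] at h6
  linarith

lemma norm_blockCol_le (X : Matrix (Fin m) (Fin p × Fin s) ℝ) (k : Fin p) :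
    ‖blockCol X k‖ ≤ ‖colsUpTo X k‖ :=
  norm_submatrix_le (colsUpTo X k) (f := fun b : Fin s => (⟨k, le_rfl⟩, b))
    fun _ _ h => (Prod.ext_iff.1 h).2

lemma norm_colsBefore_le (X : Matrix (Fin m) (Fin p × Fin s) ℝ) (k : Fin p) :
    ‖colsBefore X k‖ ≤ ‖colsUpTo X k‖ :=
  norm_submatrix_le (colsUpTo X k) (f := fun j : Before s k => (⟨j.1.1, j.1.2.le⟩, j.2)) <| by
    rintro ⟨⟨a, ha⟩, b⟩ ⟨⟨c, hc⟩, d⟩ h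
    simpa using h

lemma norm_colsUpTo_le (X : Matrix (Fin m) (Fin p × Fin s) ℝ) (k : Fin p) :
    ‖colsUpTo X k‖ ≤ ‖X‖ :=
  norm_submatrix_le X (injective_before _)

/-- Bounds for the blocks selected by `P`: `ω` for the loss of orthogonality of the columns of `Q`
and `δ` for the residual relative to the norm of the columns of `X`. -/
def SelectedBound (Q X : Matrix (Fin m) (Fin p × Fin s) ℝ)
    (R : Matrix (Fin p × Fin s) (Fin p × Fin s) ℝ) (ω δ : ℝ) (P : Fin p → Prop)
    [DecidablePred P] : Prop :=
  let f : {j : Fin p // P j} × Fin s → Fin p × Fin s := fun j => (j.1.1, j.2)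
  ‖1 - (Q.submatrix id f)ᵀ * Q.submatrix id f‖ ≤ ω ∧
    ‖Q.submatrix id f * R.submatrix f f - X.submatrix id f‖ ≤ δ * ‖X.submatrix id f‖

/-- Identifies the blocks up to `k - 1` with those before `k`, whose index types differ. -/
lemma SelectedBound.congr {Q X : Matrix (Fin m) (Fin p × Fin s) ℝ}
    {R : Matrix (Fin p × Fin s) (Fin p × Fin s) ℝ} {ω δ : ℝ} {P P' : Fin p → Prop}
    [DecidablePred P] [DecidablePred P'] (h : SelectedBound Q X R ω δ P)
    (hP : ∀ j, P j ↔ P' j) : SelectedBound Q X R ω δ P' := by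
  obtain rfl : P = P' := funext fun j => propext (hP j)
  convert h

lemma SelectedBound.of_isEmpty {Q X : Matrix (Fin m) (Fin p × Fin s) ℝ}
    {R : Matrix (Fin p × Fin s) (Fin p × Fin s) ℝ} {ω δ : ℝ} {P : Fin p → Prop}
    [DecidablePred P] (hω : 0 ≤ ω) (hδ : 0 ≤ δ) (hP : ∀ j, ¬ P j) :
    SelectedBound Q X R ω δ P := by
  have : IsEmpty {j : Fin p // P j} := ⟨fun j => hP j.1 j.2⟩
  refine ⟨?_, ?_⟩
  · rw [Subsingleton.elim (1 - _ : Matrix _ _ ℝ) 0, norm_zero]; exact hω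
  · rw [Subsingleton.elim (_ - _ : Matrix _ _ ℝ) 0, norm_zero]; positivity

end Blocks

/-! ### Induction over the blocks and choice of the constants. -/

section Run

variable {m p s : ℕ}

/-- Hypotheses of the analysis of a run: `a ζ` and `b` are the loss of orthogonality and the relative
residual of the first block. -/
structure RunHyp (ε : ℝ) (Q X : Matrix (Fin m) (Fin p × Fin s) ℝ)
    (R : Matrix (Fin p × Fin s) (Fin p × Fin s) ℝ) (a b K h ζ : ℝ) : Prop where
  eps_nonneg : 0 ≤ ε
  width_pos : 0 < s
  cols_le : p * s ≤ m
  rows_pos : 1 ≤ m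
  unit : m * roundoff ε m ≤ h
  unit_mul : m * h ≤ ζ
  orth_nonneg : 0 ≤ a
  res_nonneg : 0 ≤ b
  const : a + 22000 * p ≤ K
  sigmaMin_pos : 0 < sigmaMin X
  lower : ∀ i j, j < i → block R i j = 0
  init : ∀ k : Fin p, (k : ℕ) = 0 → ‖1 - (blockCol Q k)ᵀ * blockCol Q k‖ ≤ a * ζ ∧
    ‖blockCol Q k * block R k k - blockCol X k‖ ≤ b * ‖blockCol X k‖
  small : 4000000 * ((1 + K) ^ 2 * (ζ * ‖X‖ ^ 2)) ≤ sigmaMin X ^ 2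
  small_res : (b + 211 * p * h) * ‖X‖ ≤ sigmaMin X / 2

variable {ε : ℝ} {fl : FlArith ε} {X : Matrix (Fin m) (Fin p × Fin s) ℝ}
  {intra : Matrix (Fin m) (Fin s) ℝ → Matrix (Fin m) (Fin s) ℝ × Matrix (Fin s) (Fin s) ℝ}
  {run : PIPIPlusRun fl intra X} {a b K h ζ : ℝ}

namespace RunHyp

lemma unit_nonneg (H : RunHyp ε run.Q X run.R a b K h ζ) : 0 ≤ h :=
  (mul_nonneg (Nat.cast_nonneg m) (roundoff_nonneg H.eps_nonneg m)).trans H.unit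

lemma zeta_nonneg (H : RunHyp ε run.Q X run.R a b K h ζ) : 0 ≤ ζ :=
  (mul_nonneg (Nat.cast_nonneg m) H.unit_nonneg).trans H.unit_mul

lemma width_le (H : RunHyp ε run.Q X run.R a b K h ζ) (k : Fin p) : s ≤ m :=
  (Nat.le_mul_of_pos_left s (by have := k.isLt; omega)).trans H.cols_le

lemma card_before_le (H : RunHyp ε run.Q X run.R a b K h ζ) (k : Fin p) :
    Fintype.card (Before s k) ≤ m := by
  refine (Fintype.card_le_of_injective _ (injective_before (s := s) (· < k))).trans ?_
  simpa using H.cols_le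

/-- The hypotheses on block `k` follow from the bounds for the previous blocks. -/
lemma doubleHyp (H : RunHyp ε run.Q X run.R a b K h ζ) {t : ℕ} {k : Fin p} (ht : t < p)
    (hk : SelectedBound run.Q X run.R ((a + 22000 * t) * ζ) (b + 211 * t * h) (· < k)) :
    DoubleHyp ε m (colsBefore run.Q k) (blockCol X k) K ‖blockCol X k‖ (sigmaMin X / 2) h ζ := by
  have hh := H.unit_nonneg
  have hζ := H.zeta_nonneg
  have htp : (t : ℝ) ≤ p := by exact_mod_cast ht.le
  have hK : 0 ≤ K := le_trans (add_nonneg H.orth_nonneg (by positivity)) H.const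
  have hXk : ‖blockCol X k‖ ≤ ‖X‖ := (norm_blockCol_le X k).trans (norm_colsUpTo_le X k)
  have hXB : ‖colsBefore X k‖ ≤ ‖X‖ := (norm_colsBefore_le X k).trans (norm_colsUpTo_le X k)
  have horth : ‖1 - (colsBefore run.Q k)ᵀ * colsBefore run.Q k‖ ≤ K * ζ :=
    hk.1.trans (mul_le_mul_of_nonneg_right (by linarith [H.const]) hζ)
  -- Test on a unit vector, which exists because the blocks have positive width.
  have hσX : sigmaMin X ≤ ‖blockCol X k‖ := by
    have h1 := sigmaMin_mul_vnorm_le_submatrix X (injective_block (s := s) k)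
      (Pi.single ⟨0, H.width_pos⟩ 1)
    have h2 := vnorm_mulVec_le (blockCol X k) (Pi.single ⟨0, H.width_pos⟩ 1)
    rw [vnorm_single, mul_one] at h1 h2
    exact h1.trans h2
  have hKζ : K * ζ ≤ 1 := by
    have h1 := pow_le_pow_left₀ H.sigmaMin_pos.le (hσX.trans hXk) 2
    have h2 : 0 < ‖X‖ ^ 2 := pow_pos (H.sigmaMin_pos.trans_le (hσX.trans hXk)) 2
    have h3 : (4000000 * ((1 + K) ^ 2 * ζ)) * ‖X‖ ^ 2 ≤ 1 * ‖X‖ ^ 2 := by linarith [H.small]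
    have h4 := le_of_mul_le_mul_right h3 h2
    have h5 : K ≤ (1 + K) ^ 2 := by nlinarith [sq_nonneg K]
    have h6 := mul_le_mul_of_nonneg_right h5 hζ
    linarith [mul_nonneg hK hζ]
  refine ⟨H.eps_nonneg, le_rfl, H.width_le k, H.card_before_le k, H.rows_pos, H.unit, H.unit_mul,
    hK, horth, le_rfl, ?_, half_pos H.sigmaMin_pos, by linarith [H.sigmaMin_pos], ?_⟩
  · refine separation k H.sigmaMin_pos (norm_le_two_of_gram _ horth (by linarith))
      (hk.2.trans (le_trans ?_ H.small_res))
    have h1 := mul_le_mul_of_nonneg_right htp hh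
    exact mul_le_mul (by linarith) hXB (norm_nonneg _)
      (add_nonneg H.res_nonneg (by positivity))
  · have h1 := pow_le_pow_left₀ (norm_nonneg _) hXk 2
    have h2 := mul_le_mul_of_nonneg_left h1 (mul_nonneg (sq_nonneg (1 + K)) hζ)
    linarith [H.small]

/-- Bounds up to block `k`, by induction over the blocks. -/
lemma selectedBound (H : RunHyp ε run.Q X run.R a b K h ζ) (t : ℕ) :
    ∀ k : Fin p, (k : ℕ) = t →
      SelectedBound run.Q X run.R ((a + 22000 * t) * ζ) (b + 211 * t * h) (· ≤ k) := by
  have hh := H.unit_nonneg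
  have hζ := H.zeta_nonneg
  induction t with
  | zero =>
    intro k hk
    obtain ⟨h1, h2⟩ := H.init k hk
    have hlt : ∀ j : Fin p, ¬ j < k := fun j => by
      rw [Fin.lt_def]; omega
    have hemp : IsEmpty {j : Fin p // j < k} := ⟨fun j => hlt j.1 j.2⟩
    have hB := SelectedBound.of_isEmpty (Q := run.Q) (X := X) (R := run.R) le_rfl le_rfl hlt
    have h3 : (colsBefore run.Q k)ᵀ * blockCol run.Q k = 0 := Subsingleton.elim _ _
    have h4 : colsBefore run.Q k * aboveDiag run.R k = 0 := by
      ext i j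
      simp [Matrix.mul_apply]
    constructor
    · have := norm_one_sub_gram_upTo run.Q k hB.1 (e := 0) (by rw [h3, norm_zero]) h1
      refine this.trans_eq ?_
      simp
    · have h5 := norm_residual_upTo H.lower k hB.2 (r := b * ‖blockCol X k‖) (by
        rw [h4, zero_add]; exact h2)
      refine h5.trans ?_
      have := mul_le_mul_of_nonneg_left (norm_blockCol_le X k) H.res_nonneg
      rw [zero_mul, zero_add, Nat.cast_zero, mul_zero, zero_mul, add_zero]
      exact this
  | succ t ih =>
    intro k hk
    have hlt : t < p := by have := k.isLt; omega
    have hk0 : 0 < (k : ℕ) := by omega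
    have hB : SelectedBound run.Q X run.R ((a + 22000 * t) * ζ) (b + 211 * t * h) (· < k) :=
      (ih ⟨t, hlt⟩ rfl).congr fun j => by
        rw [Fin.le_def, Fin.lt_def, hk]
        exact Nat.lt_succ_iff.symm
    have hD := H.doubleHyp hlt hB
    have h1 := hD.cross_le (run.first k hk0) (run.second k hk0)
    have h2 := hD.one_sub_gram_le (run.first k hk0) (run.second k hk0)
    have h3 := hD.residual_le _ _ (run.R_above k hk0) (run.R_diag k hk0)
    rw [← run.Q_spec] at h1 h2 h3
    push_cast
    constructor
    -- The increment is `21000 + 2 * 400` times `ζ`, within the allotted `22000`.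
    · refine (norm_one_sub_gram_upTo run.Q k hB.1 h1 h2).trans ?_
      linarith
    · refine (norm_residual_upTo H.lower k hB.2 h3).trans ?_
      have h4 := mul_le_mul_of_nonneg_left (norm_blockCol_le X k) hh
      have h5 := mul_le_mul_of_nonneg_left (norm_colsBefore_le X k)
        (show 0 ≤ b + 211 * t * h from add_nonneg H.res_nonneg (by positivity))
      change _ ≤ (b + 211 * (t + 1) * h) * ‖colsUpTo X k‖
      change (b + 211 * t * h) * ‖colsBefore X k‖ + _ ≤ _
      linarith

lemma succeeds (H : RunHyp ε run.Q X run.R a b K h ζ) (k : Fin p) (hk : 0 < (k : ℕ)) :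
    (run.first k hk).Succeeds ∧ (run.second k hk).Succeeds := by
  have hlt : (k : ℕ) - 1 < p := by have := k.isLt; omega
  have hB := (H.selectedBound ((k : ℕ) - 1) ⟨(k : ℕ) - 1, hlt⟩ rfl).congr
    (P' := (· < k)) fun j => by
      rw [Fin.le_def, Fin.lt_def]
      simp only
      omega
  have hD := H.doubleHyp hlt hB
  exact ⟨hD.first_hyp.succeeds _, (hD.second_hyp _).succeeds _⟩

end RunHyp

section DimConst

variable (c c' : MvPolynomial (Fin 2) ℝ≥0) (M n : ℕ)

lemma dimConst_nonneg : 0 ≤ dimConst c M n := NNReal.coe_nonneg _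

lemma dimConst_add : dimConst (c + c') M n = dimConst c M n + dimConst c' M n := by
  simp [dimConst]

lemma dimConst_mul : dimConst (c * c') M n = dimConst c M n * dimConst c' M n := by
  simp [dimConst]

lemma dimConst_pow (k : ℕ) : dimConst (c ^ k) M n = dimConst c M n ^ k := by
  simp [dimConst]

lemma dimConst_one : dimConst 1 M n = 1 := by
  simp [dimConst]

lemma dimConst_ofNat (k : ℕ) [k.AtLeastTwo] :
    dimConst ofNat(k) M n = ofNat(k) := by
  simp [dimConst]

lemma dimConst_X_zero : dimConst (MvPolynomial.X 0) M n = M := by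
  simp [dimConst]

lemma dimConst_X_one : dimConst (MvPolynomial.X 1) M n = n := by
  simp [dimConst]

end DimConst

/-- Constant in the error of one matrix operation. -/
noncomputable def unitConst : MvPolynomial (Fin 2) ℝ≥0 :=
  MvPolynomial.X 0 * (2 * (MvPolynomial.X 0 + 4))

/-- Constant in the residual of BCGS-PIPI+. -/
noncomputable def outConst (cRes : MvPolynomial (Fin 2) ℝ≥0) : MvPolynomial (Fin 2) ℝ≥0 :=
  cRes + 211 * MvPolynomial.X 1 * unitConst

/-- Constant in the loss of orthogonality of BCGS-PIPI+. -/
noncomputable def orthConst (cLoo : MvPolynomial (Fin 2) ℝ≥0) : MvPolynomial (Fin 2) ℝ≥0 :=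
  2 * cLoo + 22000 * MvPolynomial.X 1

/-- Constant in the condition on the input of BCGS-PIPI+. -/
noncomputable def condConst (cRes cLoo cLoo' : MvPolynomial (Fin 2) ℝ≥0) :
    MvPolynomial (Fin 2) ℝ≥0 :=
  outConst cRes + cLoo' +
    2000000 * ((1 + orthConst cLoo) ^ 2 * (MvPolynomial.X 0 * unitConst))

/-- Lets `m` alone bound every dimension in the rounding analysis. -/
lemma card_cols_le (hX : LinearIndependent ℝ X.col) : p * s ≤ m := by
  have h := hX.fintype_card_le_finrank
  simpa using h

/-- The three summands of `condConst` serve separately: `outConst` makes the accumulated residual at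
most half of `sigmaMin X`, `cLoo'` keeps the denominator in the assumption on `intra` at least 1/2
(hence `2 * cLoo`), and the last one yields `small`. -/
lemma runHyp (hε : 0 < ε) (hp : 0 < p) (hs : 0 < s) (hX : LinearIndependent ℝ X.col)
    {cRes cLoo cLoo' : MvPolynomial (Fin 2) ℝ≥0}
    (hcond : dimConst (condConst cRes cLoo cLoo') m (p * s) * ε * cond X ^ 2 ≤ 1 / 2)
    (hintra : ∀ Y : Matrix (Fin m) (Fin s) ℝ, LinearIndependent ℝ Y.col → cond Y ≤ cond X →
      (∃ ΔD : Matrix (Fin m) (Fin s) ℝ, (intra Y).1 * (intra Y).2 = Y + ΔD ∧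
        ‖ΔD‖ ≤ dimConst cRes m (p * s) * ε * ‖Y‖) ∧
      ‖1 - (intra Y).1ᵀ * (intra Y).1‖ ≤ dimConst cLoo m (p * s) * ε /
        (1 - dimConst cLoo' m (p * s) * ε * cond Y ^ 2))
    (run : PIPIPlusRun fl intra X) :
    RunHyp ε run.Q X run.R (2 * dimConst cLoo m (p * s)) (dimConst cRes m (p * s) * ε)
      (dimConst (orthConst cLoo) m (p * s)) (dimConst unitConst m (p * s) * ε)
      (m * (dimConst unitConst m (p * s) * ε)) := by
  have hps := card_cols_le hX
  have hm : 1 ≤ m := (Nat.mul_pos hp hs).trans_le hps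
  have hmR : (1 : ℝ) ≤ m := by exact_mod_cast hm
  -- The constants may depend only on `m` and `p * s`, so the number of blocks is replaced by the
  -- number of columns.
  have hpR : (p : ℝ) ≤ (p * s : ℕ) := by exact_mod_cast Nat.le_mul_of_pos_right p hs
  have : Nonempty (Fin p × Fin s) := ⟨(⟨0, hp⟩, ⟨0, hs⟩)⟩
  have : Nonempty (Fin s) := ⟨⟨0, hs⟩⟩
  have hσ := sigmaMin_pos X hX
  have hσX : sigmaMin X ≤ ‖X‖ := by
    have h1 := sigmaMin_mul_vnorm_le X (Pi.single (⟨0, hp⟩, ⟨0, hs⟩) 1)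
    have h2 := vnorm_mulVec_le X (Pi.single (⟨0, hp⟩, ⟨0, hs⟩) 1)
    rw [vnorm_single, mul_one] at h1 h2
    exact h1.trans h2
  have hκ : 1 ≤ cond X := by rw [cond_eq]; exact (one_le_div hσ).2 hσX
  have hκ2 : cond X ≤ cond X ^ 2 := by nlinarith
  have hκ0 : 0 ≤ cond X ^ 2 := sq_nonneg _
  have hres0 := dimConst_nonneg (outConst cRes) m (p * s)
  have hloo0 := dimConst_nonneg cLoo m (p * s)
  have hloo'0 := dimConst_nonneg cLoo' m (p * s)
  have hK0 := dimConst_nonneg (orthConst cLoo) m (p * s)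
  have hu0 := dimConst_nonneg unitConst m (p * s)
  have hu : dimConst unitConst m (p * s) = m * (2 * (m + 4)) := by
    simp only [unitConst, dimConst_mul, dimConst_add, dimConst_X_zero, dimConst_ofNat]
  have hout : dimConst (outConst cRes) m (p * s) = dimConst cRes m (p * s) +
      211 * (p * s : ℕ) * dimConst unitConst m (p * s) := by
    simp only [outConst, dimConst_mul, dimConst_add, dimConst_X_one, dimConst_ofNat]
  have hK : dimConst (orthConst cLoo) m (p * s) =
      2 * dimConst cLoo m (p * s) + 22000 * (p * s : ℕ) := by
    simp only [orthConst, dimConst_mul, dimConst_add, dimConst_X_one, dimConst_ofNat]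
  rw [show dimConst (condConst cRes cLoo cLoo') m (p * s) = dimConst (outConst cRes) m (p * s) +
      dimConst cLoo' m (p * s) + 4000000 / 2 * ((1 + dimConst (orthConst cLoo) m (p * s)) ^ 2 *
      (m * dimConst unitConst m (p * s))) by
    simp only [condConst, dimConst_mul, dimConst_add, dimConst_pow, dimConst_one, dimConst_X_zero,
      dimConst_ofNat]
    norm_num] at hcond
  set cO := dimConst (outConst cRes) m (p * s)
  set cL := dimConst cLoo m (p * s)
  set cL' := dimConst cLoo' m (p * s)
  set K := dimConst (orthConst cLoo) m (p * s)
  set u := dimConst unitConst m (p * s)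
  have hO : 0 ≤ cO * ε * cond X ^ 2 := by positivity
  have hL' : 0 ≤ cL' * ε * cond X ^ 2 := by positivity
  have hZ : 0 ≤ (1 + K) ^ 2 * (m * u) * ε * cond X ^ 2 := by positivity
  have hO2 : cO * ε * cond X ^ 2 ≤ 1 / 2 := by linarith
  have hL2 : cL' * ε * cond X ^ 2 ≤ 1 / 2 := by linarith
  have hZ2 : 4000000 * ((1 + K) ^ 2 * (m * u) * ε * cond X ^ 2) ≤ 1 := by linarith
  have hXκ : ‖X‖ = cond X * sigmaMin X := by
    rw [cond_eq]; field_simp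
  refine ⟨hε.le, hs, hps, hm, ?_, le_rfl, by positivity, mul_nonneg (dimConst_nonneg _ _ _) hε.le,
    ?_, hσ, run.R_lower, ?_, ?_, ?_⟩
  · have h1 : (m + 4 : ℝ) * ε ≤ 1 := by
      have h2 : (m + 4 : ℝ) ≤ u := by rw [hu]; nlinarith
      have h3 : u ≤ m * u := le_mul_of_one_le_left hu0 hmR
      have h4 : m * u ≤ (1 + K) ^ 2 * (m * u) :=
        le_mul_of_one_le_left (by positivity) (one_le_pow₀ (by linarith))
      have h5 : (m + 4 : ℝ) * ε ≤ (1 + K) ^ 2 * (m * u) * ε :=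
        mul_le_mul_of_nonneg_right (by linarith) hε.le
      have h6 : (1 + K) ^ 2 * (m * u) * ε ≤ (1 + K) ^ 2 * (m * u) * ε * cond X ^ 2 :=
        le_mul_of_one_le_right (by positivity) (by linarith)
      linarith
    have h2 := mul_le_mul_of_nonneg_left (roundoff_le hε.le h1) (Nat.cast_nonneg (α := ℝ) m)
    rw [hu]
    linarith
  · rw [hK]; linarith
  · intro k hk
    have hi := run.init k hk
    have hQ : blockCol run.Q k = (intra (blockCol X k)).1 := congrArg Prod.fst hi
    have hR : block run.R k k = (intra (blockCol X k)).2 := congrArg Prod.snd hi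
    have hκk : cond (blockCol X k) ≤ cond X := cond_submatrix_le X (injective_block k) hσ
    have hκk0 : 0 ≤ cond (blockCol X k) := by
      rw [cond_eq]; exact div_nonneg (norm_nonneg _) (sigmaMin_nonneg _)
    obtain ⟨⟨D, hD1, hD2⟩, h2⟩ := hintra (blockCol X k)
      (hX.comp (fun b : Fin s => (k, b)) (injective_block k)) hκk
    rw [hQ, hR]
    constructor
    · refine h2.trans ?_
      have h3 : cL' * ε * cond (blockCol X k) ^ 2 ≤ 1 / 2 :=
        (mul_le_mul_of_nonneg_left (pow_le_pow_left₀ hκk0 hκk 2) (by positivity)).trans hL2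
      have h4 : cL * ε / (1 - cL' * ε * cond (blockCol X k) ^ 2) ≤ cL * ε / (1 / 2) :=
        div_le_div_of_nonneg_left (by positivity) (by norm_num) (by linarith)
      refine h4.trans ?_
      -- Turns the multiple of `ε` assumed for the first block into a multiple of `ζ = m * u * ε`.
      have h5 : 1 ≤ m * u := by
        rw [hu]
        nlinarith
      have h6 := mul_le_mul_of_nonneg_left h5 (show 0 ≤ 2 * cL * ε by positivity)
      linarith
    · rw [hD1, add_sub_cancel_left]
      exact hD2
  · rw [hXκ, mul_pow]
    have := mul_le_mul_of_nonneg_right hZ2 (sq_nonneg (sigmaMin X))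
    linarith
  · have h1 : (dimConst cRes m (p * s) * ε + 211 * p * (u * ε)) * ‖X‖ ≤ cO * ε * ‖X‖ := by
      refine mul_le_mul_of_nonneg_right ?_ (norm_nonneg _)
      have := mul_le_mul_of_nonneg_right hpR (show 0 ≤ u * ε by positivity)
      rw [hout]
      linarith
    refine h1.trans ?_
    rw [hXκ]
    have h2 : cO * ε * cond X ≤ 1 / 2 :=
      (mul_le_mul_of_nonneg_left hκ2 (by positivity)).trans hO2
    have := mul_le_mul_of_nonneg_right h2 hσ.le
    linarith

end Run

end BlockGS

theorem mainTheorem5 :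
    -- the constants in the assumptions on the intraorthogonalization routine
    ∀ cRes cLoo cLoo' : MvPolynomial (Fin 2) ℝ≥0,
    -- the constants in the condition on the input and in the conclusion
    ∃ cCond cOut : MvPolynomial (Fin 2) ℝ≥0,
    ∀ (m p s : ℕ) (ε : ℝ), 0 < ε → ∀ (fl : BlockGS.FlArith ε)
      (X : Matrix (Fin m) (Fin p × Fin s) ℝ)
      (intra : Matrix (Fin m) (Fin s) ℝ → Matrix (Fin m) (Fin s) ℝ × Matrix (Fin s) (Fin s) ℝ),
    LinearIndependent ℝ X.col →
    BlockGS.dimConst cCond m (p * s) * ε * BlockGS.cond X ^ 2 ≤ 1 / 2 →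
    (∀ Y : Matrix (Fin m) (Fin s) ℝ, LinearIndependent ℝ Y.col →
      BlockGS.cond Y ≤ BlockGS.cond X →
        (∃ ΔD : Matrix (Fin m) (Fin s) ℝ, (intra Y).1 * (intra Y).2 = Y + ΔD ∧
          ‖ΔD‖ ≤ BlockGS.dimConst cRes m (p * s) * ε * ‖Y‖) ∧
        ‖1 - (intra Y).1ᵀ * (intra Y).1‖ ≤ BlockGS.dimConst cLoo m (p * s) * ε /
          (1 - BlockGS.dimConst cLoo' m (p * s) * ε * BlockGS.cond Y ^ 2)) →
    ∀ run : BlockGS.PIPIPlusRun fl intra X,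
      (∀ (k : Fin p) (hk : 0 < (k : ℕ)),
        (run.first k hk).Succeeds ∧ (run.second k hk).Succeeds) ∧
      ∀ k : Fin p, ∃ ΔD : Matrix (Fin m) (BlockGS.UpTo s k) ℝ,
        BlockGS.colsUpTo run.Q k * BlockGS.leading run.R k = BlockGS.colsUpTo X k + ΔD ∧
        ‖ΔD‖ ≤ BlockGS.dimConst cOut m (p * s) * ε * ‖BlockGS.colsUpTo X k‖ := by
  intro cRes cLoo cLoo'
  refine ⟨BlockGS.condConst cRes cLoo cLoo', BlockGS.outConst cRes, ?_⟩
  intro m p s ε hε fl X intra hX hcond hintra run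
  -- Without columns there is no smallest singular value to work with, and `p ≤ p * s` may fail;
  -- both degenerate cases are trivial.
  rcases Nat.eq_zero_or_pos s with rfl | hs
  · refine ⟨fun k hk => ⟨fun j => j.elim0, fun j => j.elim0⟩, fun k =>
      ⟨0, Subsingleton.elim _ _, ?_⟩⟩
    rw [norm_zero]
    exact mul_nonneg (mul_nonneg (BlockGS.dimConst_nonneg _ _ _) hε.le) (norm_nonneg _)
  rcases Nat.eq_zero_or_pos p with rfl | hp
  · exact ⟨fun k => k.elim0, fun k => k.elim0⟩
  have H := BlockGS.runHyp hε hp hs hX hcond hintra run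
  refine ⟨H.succeeds, fun k => ⟨BlockGS.colsUpTo run.Q k * BlockGS.leading run.R k -
    BlockGS.colsUpTo X k, by abel, (H.selectedBound k k rfl).2.trans ?_⟩⟩
  refine mul_le_mul_of_nonneg_right ?_ (norm_nonneg _)
  have hk : (k : ℝ) ≤ (p * s : ℕ) := by
    exact_mod_cast k.isLt.le.trans (Nat.le_mul_of_pos_right p hs)
  have h1 := mul_le_mul_of_nonneg_right hk H.unit_nonneg
  simp only [BlockGS.outConst, BlockGS.dimConst_mul, BlockGS.dimConst_add,
    BlockGS.dimConst_X_one, BlockGS.dimConst_ofNat]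
  linarith
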